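/- **Conventions.** Let $\mathcal L$ be a first-order language containing symbols $<,0,+$, and let $T$ be a complete o-minimal $\mathcal L$-theory (in every model of $T$, the symbol $<$ is a total order and every subset of the model that is definable with parameters is a finite union of points and open intervals) all of whose models are ordered abelian groups. Assume that $T$ has quantifier elimination and a universal axiomatization. Let $\mathcal L(\mathfrak f)$ be $\mathcal L$ together with a new unary function symbol $\mathfrak f$, let $T(\mathfrak f)$ be a complete $\mathcal L(\mathfrak f)$-theory extending $T$, and let $\mathbb M$ be a monster model of $T(\mathfrak f)$, that is, a model which is $\kappa$-saturated and strongly $\kappa$-homogeneous for some $\kappa>\max(|\mathcal L(\mathfrak f)|,\aleph_0)$. Indiscernible sequences in models of $T(\mathfrak f)$ are indiscernible over $\emptyset$ with respect to $\mathcal L(\mathfrak f)$. For a subset $X$ of a model $\mathcal A$ of $T$, $\langle X\rangle$ denotes the $\mathcal L$-substructure of $\mathcal A$ generated by $X$, and $\mathcal B\langle X\rangle:=\langle B\cup X\rangle$ for $\mathcal B\preceq\mathcal A$. A complete theory $T'$ is *dependent* if for every formula $\varphi(\vec x,\vec y)$, every indiscernible sequence $(\vec a_i)_{i\in\omega}$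 and every tuple $\vec b$ in a monster model of $T'$, the truth value of $\varphi(\vec a_i,\vec b)$ is constant for all sufficiently large $i$. **Theorem.** Suppose that the following conditions hold. 1. The theory $T(\mathfrak f)$ has quantifier elimination. 2. For every $(\mathcal A,\mathfrak f)\models T(\mathfrak f)$, every $\mathcal L$-elementary substructure $\mathcal B\preceq\mathcal A$ with $\mathfrak f(B)\subseteq B$, every $n\ge 0$ and all $c_1,\dots,c_n\in A$, there are $d_1,\dots,d_n\in A$ such that $$\mathfrak f\big(\mathcal B\langle c_1,\dots,c_n\rangle\big)\subseteq\langle \mathfrak f(B)\cup\{d_1,\dots,d_n\}\rangle .$$ 3. For all $m,k,n,l\ge 0$ with $n\le m$, all $\mathcal L$-terms $f$ and $g$ of arities $m+k$ and $n+l$ respectively, every indiscernible sequence $(\vec a_i)_{i\in\omega}$ from $\mathbb M^m$ with $a_{i,1},\dots,a_{i,n}\in\mathfrak f(\mathbb M)$ for every $i\in\omega$, every $\vec b_1\in\mathbb M^k$ and every $\vec b_2\in(\mathfrak f(\mathbb M))^l$, the set $$\big\{i\in\omega:\ \mathbb M\models \mathfrak f(f(\vec a_i,\vec b_1))=g(a_{i,1},\dots,a_{i,n},\vec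 b_2)\big\}$$ is finite or cofinite. Then $T(\mathfrak f)$ is dependent. -/

import Mathlib

open FirstOrder Cardinal

universe u v w

namespace PairNIP

open FirstOrder.Language

/-! ### The language `L(f)` -/

/-- The symbols of the language with exactly one symbol, a unary function symbol. -/
inductive UnaryFunc : ℕ → Type
  | f : UnaryFunc 1

/-- The language whose only symbol is a unary function symbol. -/
def unaryLanguage : FirstOrder.Language.{0, 0} := ⟨UnaryFunc, fun _ => Empty⟩

/-- `L(f)`: the language `L` together with one new unary function symbol. If `A` is a structure for
`L` and for `unaryLanguage`, then it is a structure for `L(f)` through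
`FirstOrder.Language.sumStructure`. -/
abbrev addUnary (L : FirstOrder.Language.{u, v}) : Language := L.sum unaryLanguage

/-- The interpretation of the new unary function symbol. -/
def theMap (A : Type w) [unaryLanguage.Structure A] (a : A) : A :=
  Structure.funMap (L := unaryLanguage) UnaryFunc.f ![a]

/-- The `L(f)`-theory `Tf` extends the `L`-theory `T`. -/
def Extends {L : FirstOrder.Language.{u, v}} (Tf : (addUnary L).Theory) (T : L.Theory) : Prop :=
  ∀ φ ∈ T, Tf ⊨ᵇ (LHom.sumInl : L →ᴸ addUnary L).onSentence φ

/-! ### Quantifier elimination and universal axiomatizations -/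

/-- Every formula is equivalent modulo `T` to a quantifier-free formula in the same variables. -/
def HasQE {L : FirstOrder.Language.{u, v}} (T : L.Theory) : Prop :=
  ∀ (n : ℕ) (φ : L.Formula (Fin n)), ∃ ψ : L.Formula (Fin n), ψ.IsQF ∧ (φ ⇔[T] ψ)

/-- `T` has the same consequences as some set of universal sentences. -/
def HasUniversalAxiomatization {L : FirstOrder.Language.{u, v}} (T : L.Theory) : Prop :=
  ∃ U : L.Theory, U.IsUniversal ∧ ∀ φ : L.Sentence, (U ⊨ᵇ φ) ↔ (T ⊨ᵇ φ)

/-! ### Ordered abelian groups and o-minimality -/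

/-- The symbols `<`, `0`, `+` in a language. (A symbol for negation may or may not be present.) -/
structure OrderedGroupSymbols (L : FirstOrder.Language.{u, v}) where
  lt : L.Relations 2
  zero : L.Functions 0
  add : L.Functions 2

section Interpretation

variable {L : FirstOrder.Language.{u, v}} (S : OrderedGroupSymbols L) (A : Type w) [L.Structure A]

/-- The interpretation of `<`. -/
def OrderedGroupSymbols.ltOn (a b : A) : Prop := Structure.RelMap S.lt ![a, b]

/-- The interpretation of `0`. -/
def OrderedGroupSymbols.zeroOn : A := Structure.funMap S.zero ![]

/-- The interpretation of `+`. -/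
def OrderedGroupSymbols.addOn (a b : A) : A := Structure.funMap S.add ![a, b]

/-- `(A, <, 0, +)` is a model of the theory of (totally) ordered abelian groups. -/
structure IsOrderedAbelianGroup : Prop where
  add_assoc : ∀ a b c : A, S.addOn A (S.addOn A a b) c = S.addOn A a (S.addOn A b c)
  add_comm : ∀ a b : A, S.addOn A a b = S.addOn A b a
  zero_add : ∀ a : A, S.addOn A (S.zeroOn A) a = a
  exists_neg : ∀ a : A, ∃ b : A, S.addOn A a b = S.zeroOn A
  total_order : IsStrictTotalOrder A (S.ltOn A)
  add_lt_add : ∀ a b c : A, S.ltOn A a b → S.ltOn A (S.addOn A a c) (S.addOn A b c)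

variable {A} in
/-- Points, and open intervals with endpoints in `A ∪ {-∞, +∞}`, for a relation `r` on `A`. -/
inductive IsPointOrInterval (r : A → A → Prop) : Set A → Prop
  | point (a : A) : IsPointOrInterval r {a}
  | Ioo (a b : A) : IsPointOrInterval r {x | r a x ∧ r x b}
  | Ioi (a : A) : IsPointOrInterval r {x | r a x}
  | Iio (b : A) : IsPointOrInterval r {x | r x b}
  | univ : IsPointOrInterval r Set.univ

/-- `A` is an o-minimal structure: `<` is a total order, and every subset of `A` that is definable
with parameters is a finite union of points and open intervals. -/
def OMinimal : Prop :=
  IsStrictTotalOrder A (S.ltOn A) ∧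
    ∀ X : Set A, (Set.univ : Set A).Definable₁ L X →
      ∃ F : Set (Set A), F.Finite ∧ (∀ I ∈ F, IsPointOrInterval (S.ltOn A) I) ∧ X = ⋃₀ F

end Interpretation

/-- Every model of `T` (in `Type w`) is an ordered abelian group. -/
def ExtendsOrderedAbelianGroups {L : FirstOrder.Language.{u, v}} (S : OrderedGroupSymbols L)
    (T : L.Theory) : Prop :=
  ∀ (A : Type w) [L.Structure A] [Nonempty A], A ⊨ T → IsOrderedAbelianGroup S A

/-- Every model of `T` (in `Type w`) is o-minimal. -/
def OMinimalTheory {L : FirstOrder.Language.{u, v}} (S : OrderedGroupSymbols L) (T : L.Theory) : Prop :=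
  ∀ (A : Type w) [L.Structure A] [Nonempty A], A ⊨ T → OMinimal S A

/-! ### Monster models, indiscernible sequences, dependence -/

section Monster

variable (L : FirstOrder.Language.{u, v}) (M : Type w) [L.Structure M]

/-- `M` is `κ`-saturated: every set of formulas in one variable `x` (here the point of `Unit`) over a
set of fewer than `κ` parameters that is finitely satisfiable in `M` is realized in `M`. -/
def Saturated (κ : Cardinal.{w}) : Prop :=
  ∀ C : Set M, #C < κ → ∀ p : Set (L.Formula (C ⊕ Unit)),
    (∀ q : Finset (L.Formula (C ⊕ Unit)), (q : Set (L.Formula (C ⊕ Unit))) ⊆ p →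
      ∃ x : M, ∀ φ ∈ q, φ.Realize (Sum.elim (fun c : C => (c : M)) fun _ => x)) →
    ∃ x : M, ∀ φ ∈ p, φ.Realize (Sum.elim (fun c : C => (c : M)) fun _ => x)

/-- `M` is strongly `κ`-homogeneous: every partial elementary map defined on a set of fewer than `κ`
elements of `M` extends to an automorphism of `M`. -/
def StronglyHomogeneous (κ : Cardinal.{w}) : Prop :=
  ∀ C : Set M, #C < κ → ∀ h : C → M,
    (∀ φ : L.Formula C, φ.Realize (fun c : C => (c : M)) ↔ φ.Realize h) →
    ∃ σ : M ≃[L] M, ∀ c : C, σ c = h c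

variable {L}

/-- `M` is a monster model of `T`: a `κ`-saturated and strongly `κ`-homogeneous model, where `κ` is
uncountable and larger than the number of symbols of the language. -/
structure IsMonster (T : L.Theory) (κ : Cardinal.{w}) : Prop where
  model : M ⊨ T
  aleph0_lt : ℵ₀ < κ
  card_lt : Cardinal.lift.{w} L.card < Cardinal.lift.{max u v} κ
  saturated : Saturated L M κ
  homogeneous : StronglyHomogeneous L M κ

variable {M}

variable (L) in
/-- The sequence `(a i)` of `p`-tuples is indiscernible (over the empty set). -/
def Indiscernible {p : ℕ} (a : ℕ → Fin p → M) : Prop :=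
  ∀ (r : ℕ) (φ : L.Formula (Fin r × Fin p)) (i j : Fin r → ℕ), StrictMono i → StrictMono j →
    (φ.Realize (fun s => a (i s.1) s.2) ↔ φ.Realize (fun s => a (j s.1) s.2))

variable (M) in
/-- The formula `φ(x, y)` is dependent, as tested in `M`: along every indiscernible sequence
`(a i)`, and for every `b`, the truth value of `φ(a i, b)` is eventually constant. -/
def DependentFormula {p q : ℕ} (φ : L.Formula (Fin p ⊕ Fin q)) : Prop :=
  ∀ a : ℕ → Fin p → M, Indiscernible L a → ∀ b : Fin q → M,
    ∃ i₀ : ℕ, (∀ i, i₀ < i → φ.Realize (Sum.elim (a i) b)) ∨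
      (∀ i, i₀ < i → ¬ φ.Realize (Sum.elim (a i) b))

end Monster

/-- The theory `T` is dependent: in monster models of `T` (in `Type w`) every formula is
dependent. -/
def DependentTheory {L : FirstOrder.Language.{u, v}} (T : L.Theory) : Prop :=
  ∀ (M : Type w) [L.Structure M] [Nonempty M] (κ : Cardinal.{w}), IsMonster M T κ →
    ∀ (p q : ℕ) (φ : L.Formula (Fin p ⊕ Fin q)), DependentFormula M φ

end PairNIP

/-! Quantifier elimination reduces the theorem to quantifier-free `L(f)`-formulas, that is, to
Boolean combinations of `L`-definable relations evaluated at `L(f)`-terms. The proof removes the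
occurrences of `f` one at a time. The inductive class is `DependentUnderTerms`: relations all of
whose substitution instances by `L`-terms, with arbitrary parameters, are dependent. It contains the
`L`-definable relations because o-minimal structures are dependent: along an indiscernible sequence
the endpoints of the cells of `φ(a_i, ·)` move monotonically, so a single point `b` eventually keeps
its position among them, and several parameters are handled by induction on their number.

The heart is `DependentUnderTerms.theMap`: if `S(v, x)` is in the class, so is `S(v, f(v_w))`.
Suppose an instance of it alternates along an indiscernible sequence. By saturation the sequence can
be stretched to `c` indexed by `κ ×ₗ Bool`, with parameters `d`, so that the relation holds exactly
at the indices `(l, false)`. Let `B` be the `L(f)`-substructure generated by those `c_(l, false)`.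
By condition 2, `f(B⟨d⟩)` lies in `⟨f(B), e⟩` for a finite tuple `e`, and the exchange property lets
`e` be chosen in the image of `f`. So `f(τ_w(c_(l, false), d))` is an `L`-term in `e` and finitely
many values of `f` on `B`. There are fewer than `κ` shapes of such expressions, so infinitely many
`l` share one, and Ramsey's theorem makes the order pattern of the indices involved uniform.

Now move every second member of this subsequence from `(l, false)` to `(l, true)`, keeping the order
pattern. The resulting sequence is indiscernible, and the equation between the `f`-value and the
`L`-term holds at its even members, hence by condition 3 at almost all members. Replacing the
`f`-value by the `L`-term turns the alternating relation into a term instance of `S`, which cannot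
alternate. -/

namespace PairNIP

open FirstOrder.Language Filter

/-! ### Relations definable without parameters -/

section Definable

variable {L : FirstOrder.Language.{u, v}} {M : Type w} [L.Structure M]

variable (L) in
/-- The relation `R` is defined in `M` by an `L`-formula without parameters. -/
def IsDef {α : Type*} (R : (α → M) → Prop) : Prop :=
  ∃ φ : L.Formula α, ∀ v, φ.Realize v ↔ R v

variable {α β : Type*} {R R' : (α → M) → Prop}

theorem IsDef.of_formula (φ : L.Formula α) : IsDef L (M := M) φ.Realize := ⟨φ, fun _ => Iff.rfl⟩

theorem IsDef.not (h : IsDef L R) : IsDef L fun v => ¬ R v := by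
  obtain ⟨φ, hφ⟩ := h
  exact ⟨φ.not, fun v => by rw [Formula.realize_not, hφ]⟩

theorem IsDef.imp (h : IsDef L R) (h' : IsDef L R') : IsDef L fun v => R v → R' v := by
  obtain ⟨φ, hφ⟩ := h
  obtain ⟨φ', hφ'⟩ := h'
  exact ⟨φ.imp φ', fun v => by rw [Formula.realize_imp, hφ, hφ']⟩

theorem IsDef.and (h : IsDef L R) (h' : IsDef L R') : IsDef L fun v => R v ∧ R' v := by
  obtain ⟨φ, hφ⟩ := h
  obtain ⟨φ', hφ'⟩ := h'
  exact ⟨φ ⊓ φ', fun v => by rw [Formula.realize_inf, hφ, hφ']⟩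

theorem IsDef.iff (h : IsDef L R) (h' : IsDef L R') : IsDef L fun v => (R v ↔ R' v) := by
  obtain ⟨φ, hφ⟩ := h
  obtain ⟨φ', hφ'⟩ := h'
  exact ⟨φ.iff φ', fun v => by rw [Formula.realize_iff, hφ, hφ']⟩

theorem IsDef.forall_finite {ι : Type*} [Finite ι] {R : ι → (α → M) → Prop}
    (h : ∀ i, IsDef L (R i)) : IsDef L fun v => ∀ i, R i v := by
  choose φ hφ using h
  exact ⟨Formula.iInf φ, fun v => by simp only [Formula.realize_iInf, hφ]⟩

theorem IsDef.exists_tuple {γ : Type*} [Finite γ] {Q : (α → M) → (γ → M) → Prop}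
    (h : IsDef L fun v : α ⊕ γ → M => Q (v ∘ Sum.inl) (v ∘ Sum.inr)) :
    IsDef L fun v => ∃ x, Q v x := by
  obtain ⟨φ, hφ⟩ := h
  exact ⟨φ.iExs γ, fun v => by simp only [Formula.realize_iExs, hφ, Sum.elim_comp_inl,
    Sum.elim_comp_inr]⟩

theorem IsDef.ex {Q : (α → M) → M → Prop}
    (h : IsDef L fun v : α ⊕ Unit → M => Q (v ∘ Sum.inl) (v (Sum.inr ()))) :
    IsDef L fun v => ∃ x, Q v x := by
  obtain ⟨φ, hφ⟩ := IsDef.exists_tuple (Q := fun v (x : Unit → M) => Q v (x ())) h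
  exact ⟨φ, fun v => (hφ v).trans ⟨fun ⟨x, hx⟩ => ⟨x (), hx⟩, fun ⟨x, hx⟩ => ⟨fun _ => x, hx⟩⟩⟩

theorem IsDef.congr (h : IsDef L R) (h' : ∀ v, R v ↔ R' v) : IsDef L R' := by
  obtain ⟨φ, hφ⟩ := h
  exact ⟨φ, fun v => (hφ v).trans (h' v)⟩

theorem IsDef.all {Q : (α → M) → M → Prop}
    (h : IsDef L fun v : α ⊕ Unit → M => Q (v ∘ Sum.inl) (v (Sum.inr ()))) :
    IsDef L fun v => ∀ x, Q v x :=
  (IsDef.ex (Q := fun v x => ¬ Q v x) h.not).not.congr fun v => by simp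

theorem IsDef.subst (h : IsDef L R) (t : α → L.Term β) :
    IsDef L fun v : β → M => R fun x => (t x).realize v := by
  obtain ⟨φ, hφ⟩ := h
  exact ⟨φ.subst t, fun v => BoundedFormula.realize_subst.trans (hφ _)⟩

theorem IsDef.comp (h : IsDef L R) (g : α → β) : IsDef L fun v : β → M => R (v ∘ g) :=
  h.subst fun x => Term.var (g x)

theorem IsDef.eq (x y : α) : IsDef L fun v : α → M => v x = v y :=
  ⟨(Term.var x).equal (Term.var y), fun v => by simp [Formula.realize_equal]⟩

theorem IsDef.onFormula {L' : FirstOrder.Language} [L'.Structure M] (ϕ : L →ᴸ L')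
    [ϕ.IsExpansionOn M] (h : IsDef L R) : IsDef L' R := by
  obtain ⟨φ, hφ⟩ := h
  exact ⟨ϕ.onFormula φ, fun v => by rw [LHom.realize_onFormula, hφ]⟩

end Definable

/-! ### Saturation in many variables -/

section Saturation

variable {L : FirstOrder.Language.{u, v}} {M : Type w} [L.Structure M]

/-- Transfinite recursion along `W`. Each value is chosen by one-variable saturation over the
earlier values, of which there are fewer than `κ`. The invariant `Q s` says that the values on `s`
satisfy every formula that holds eventually; it passes limits because a formula mentions finitely
many variables. -/
theorem exists_realize_of_eventually_wellOrder [Nonempty M] {κ : Cardinal.{w}} (hsat : Saturated L M κ)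
    {N : Type*} [L.Structure N] (hNM : ∀ φ : L.Sentence, N ⊨ φ → M ⊨ φ)
    {ι : Type*} (l : Filter ι) [l.NeBot]
    {W : Type w} [LinearOrder W] [WellFoundedLT W] (hW : ∀ v : W, #(Set.Iio v) < κ)
    (e : ι → W → N) :
    ∃ e' : W → M, ∀ φ : L.Formula W, (∀ᶠ j in l, φ.Realize (e j)) → φ.Realize e' := by
  classical
  let Q : Set W → (W → M) → Prop := fun s x => ∀ φ : L.Formula s,
    (∀ᶠ j in l, φ.Realize (fun i : s => e j i)) → φ.Realize (fun i : s => x i)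
  have Qmono : ∀ {s t : Set W} {x : W → M}, s ⊆ t → Q t x → Q s x := by
    intro s t x hst h φ hφ
    have := h (φ.relabel (Set.inclusion hst)) (by
      filter_upwards [hφ] with j hj
      rw [Formula.realize_relabel]
      exact hj)
    rw [Formula.realize_relabel] at this
    exact this
  -- A formula without variables is a sentence; this base case is where the relation between the
  -- theories of `N` and `M` enters.
  have Qempty : ∀ x, Q ∅ x := by
    intro x φ hφ
    obtain ⟨j, hj⟩ := hφ.exists
    have h1 : N ⊨ (φ.relabel (fun i => i.2.elim : (∅ : Set W) → Empty) : L.Sentence) := by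
      unfold Sentence.Realize
      rw [Formula.realize_relabel]
      convert hj using 1
      funext i; exact i.2.elim
    have h2 := hNM _ h1
    unfold Sentence.Realize at h2
    rw [Formula.realize_relabel] at h2
    convert h2 using 1
    funext i; exact i.2.elim
  have Qfin : ∀ {s : Set W} {x : W → M}, (∀ t : Finset W, (t : Set W) ⊆ s → Q t x) → Q s x := by
    intro s x h φ hφ
    have hsub : ((φ.freeVarFinset.image Subtype.val : Finset W) : Set W) ⊆ s := by
      intro i hi
      simp only [Finset.coe_image, Set.mem_image] at hi
      obtain ⟨a, _, rfl⟩ := hi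
      exact a.2
    have key : ∀ {P : Type _} [L.Structure P] (y : W → P),
        Formula.Realize (φ.restrictFreeVar (fun a : φ.freeVarFinset =>
          (⟨a.1.1, Finset.mem_coe.2 (Finset.mem_image_of_mem _ a.2)⟩ :
            ((φ.freeVarFinset.image Subtype.val : Finset W) : Set W)))) (fun i => y i) ↔
          φ.Realize (fun i : s => y i) := fun y =>
      BoundedFormula.realize_restrictFreeVar _ (fun a => rfl)
    have key' : ∀ (y : W → N),
        Formula.Realize (φ.restrictFreeVar (fun a : φ.freeVarFinset =>
          (⟨a.1.1, Finset.mem_coe.2 (Finset.mem_image_of_mem _ a.2)⟩ :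
            ((φ.freeVarFinset.image Subtype.val : Finset W) : Set W)))) (fun i => y i) ↔
          φ.Realize (fun i : s => y i) := fun y =>
      BoundedFormula.realize_restrictFreeVar _ (fun a => rfl)
    refine (key x).1 (h _ hsub _ ?_)
    filter_upwards [hφ] with j hj
    exact (key' (e j)).2 hj
  have step : ∀ (v : W) (x : W → M), Q (Set.Iio v) x → ∃ y : M,
      ∀ φ : L.Formula (Set.Iio v ⊕ Unit),
        (∀ᶠ j in l, φ.Realize (Sum.elim (fun i : Set.Iio v => e j i) fun _ => e j v)) →
        φ.Realize (Sum.elim (fun i : Set.Iio v => x i) fun _ => y) := by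
    intro v x hx
    let C : Set M := x '' Set.Iio v
    let ρ : Set.Iio v ⊕ Unit → C ⊕ Unit :=
      Sum.map (fun i => ⟨x i, Set.mem_image_of_mem _ i.2⟩) id
    let p : Set (L.Formula (C ⊕ Unit)) := {ψ | ∃ φ : L.Formula (Set.Iio v ⊕ Unit),
      (∀ᶠ j in l, φ.Realize (Sum.elim (fun i : Set.Iio v => e j i) fun _ => e j v)) ∧
      ψ = φ.relabel ρ}
    have hρ : ∀ y : M, Sum.elim (fun c : C => (c : M)) (fun _ => y) ∘ ρ =
        Sum.elim (fun i : Set.Iio v => x i) fun _ => y := by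
      intro y; funext i; rcases i with i | i <;> rfl
    -- Finite satisfiability: the existential closure of a finite conjunction holds eventually,
    -- witnessed by `e j v`, and uses only variables below `v`, so the invariant transfers it to
    -- `M`.
    obtain ⟨y, hy⟩ := hsat C (Cardinal.mk_image_le.trans_lt (hW v)) p (by
      intro q hq
      choose φ hφ hφ' using fun ψ : q => hq ψ.2
      have h1 := hx ((Formula.iInf φ).iExs Unit) (by
        filter_upwards [eventually_all.2 hφ] with j hj
        rw [Formula.realize_iExs]
        exact ⟨fun _ => e j v, Formula.realize_iInf.2 hj⟩)
      rw [Formula.realize_iExs] at h1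
      obtain ⟨y, hy⟩ := h1
      refine ⟨y (), fun ψ hψ => ?_⟩
      have hψ' : ψ = (φ ⟨ψ, hψ⟩).relabel ρ := hφ' ⟨ψ, hψ⟩
      rw [hψ', Formula.realize_relabel, hρ]
      exact Formula.realize_iInf.1 hy ⟨ψ, hψ⟩)
    refine ⟨y, fun φ hφ => ?_⟩
    have := hy _ ⟨φ, hφ, rfl⟩
    rwa [Formula.realize_relabel, hρ] at this
  -- The arbitrary value in the other branch is never taken: `Qle` shows that the required `y`
  -- exists at every stage.
  let F : (v : W) → ((u : W) → u < v → M) → M := fun v ih =>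
    if h : ∃ y : M, ∀ φ : L.Formula (Set.Iio v ⊕ Unit),
        (∀ᶠ j in l, φ.Realize (Sum.elim (fun i : Set.Iio v => e j i) fun _ => e j v)) →
        φ.Realize (Sum.elim (fun i : Set.Iio v => ih i i.2) fun _ => y) then h.choose
    else Classical.arbitrary M
  let e' : W → M := (wellFounded_lt (α := W)).fix F
  have he' : ∀ v, e' v = F v fun u _ => e' u := fun v => WellFounded.fix_eq _ F v
  have Qlt : ∀ s : Set W, (∀ v ∈ s, Q (Set.Iic v) e') → Q s e' := by
    intro s h
    refine Qfin fun t ht => ?_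
    rcases t.eq_empty_or_nonempty with rfl | hne
    · rw [Finset.coe_empty]
      exact Qempty e'
    · exact Qmono (fun i hi => t.le_max' i hi) (h _ (ht (t.max'_mem hne)))
  have Qle : ∀ v, Q (Set.Iic v) e' := by
    intro v
    induction v using (wellFounded_lt (α := W)).induction with
    | _ v ih =>
    have h := step v e' (Qlt _ ih)
    have hv : e' v = h.choose := (he' v).trans (dif_pos h)
    intro φ hφ
    let g : Set.Iic v → Set.Iio v ⊕ Unit := fun i =>
      if hi : i.1 < v then Sum.inl ⟨i, hi⟩ else Sum.inr ()
    have hg : ∀ {P : Type _} (x : W → P), Sum.elim (fun i : Set.Iio v => x i) (fun _ => x v) ∘ g =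
        fun i : Set.Iic v => x i := by
      intro P x
      funext i
      by_cases hi : i.1 < v
      · simp [g, hi]
      · have : i.1 = v := le_antisymm i.2 (not_lt.1 hi)
        simp [g, this]
    have hg' : ∀ (x : W → N), Sum.elim (fun i : Set.Iio v => x i) (fun _ => x v) ∘ g =
        fun i : Set.Iic v => x i := by
      intro x
      funext i
      by_cases hi : i.1 < v
      · simp [g, hi]
      · have : i.1 = v := le_antisymm i.2 (not_lt.1 hi)
        simp [g, this]
    have := h.choose_spec (φ.relabel g) (by
      filter_upwards [hφ] with j hj
      rw [Formula.realize_relabel, hg']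
      exact hj)
    rw [← hv, Formula.realize_relabel, hg] at this
    exact this
  refine ⟨e', fun φ hφ => ?_⟩
  have := Qlt Set.univ (fun v _ => Qle v) (φ.relabel fun i => ⟨i, trivial⟩) (by
    filter_upwards [hφ] with j hj
    rw [Formula.realize_relabel]
    exact hj)
  rw [Formula.realize_relabel] at this
  exact this

/-- A saturated structure realizes, in at most `κ` variables, every set of formulas that hold
eventually along a family of assignments in an elementarily equivalent structure. -/
theorem exists_realize_of_eventually [Nonempty M] {κ : Cardinal.{w}} (hsat : Saturated L M κ)
    {N : Type*} [L.Structure N] [Nonempty N] (hNM : ∀ φ : L.Sentence, N ⊨ φ → M ⊨ φ)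
    {ι : Type*} (l : Filter ι) [l.NeBot] {V : Type*} (hV : Cardinal.lift.{w} #V ≤ Cardinal.lift κ)
    (e : ι → V → N) :
    ∃ e' : V → M, ∀ φ : L.Formula V, (∀ᶠ j in l, φ.Realize (e j)) → φ.Realize e' := by
  rw [← Cardinal.mk_ord_toType κ, Cardinal.lift_mk_le'] at hV
  obtain ⟨g⟩ := hV
  obtain ⟨e', he'⟩ := exists_realize_of_eventually_wellOrder hsat hNM l
    (fun v : κ.ord.ToType => (Cardinal.mk_Iio_lt v (by simp)).trans_eq (Cardinal.mk_ord_toType κ))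
    (fun j => Function.extend g (e j) fun _ => Classical.arbitrary N)
  refine ⟨e' ∘ g, fun φ hφ => ?_⟩
  rw [← Formula.realize_relabel]
  refine he' _ ?_
  filter_upwards [hφ] with j hj
  rwa [Formula.realize_relabel, Function.extend_comp g.injective]

end Saturation

/-- Ramsey's theorem for pairs of natural numbers. -/
theorem exists_strictMono_homogeneous {K : Type*} [Finite K] (c : ℕ → ℕ → K) :
    ∃ (g : ℕ → ℕ) (k : K), StrictMono g ∧ ∀ i j, i < j → c (g i) (g j) = k := by
  have key : ∀ f : ℕ → K, ∃ k, ∀ᶠ n in (hyperfilter ℕ : Filter ℕ), f n = k := by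
    -- Along a nonprincipal ultrafilter each `c i` has a limit colour `d i`, and `d` itself has a
    -- limit colour `k`; the homogeneous subsequence is then picked greedily among the `n` with `d n
    -- = k`.
    intro f
    by_contra! h
    have h' : ∀ k, ∀ᶠ n in (hyperfilter ℕ : Filter ℕ), f n ≠ k := fun k =>
      Ultrafilter.frequently_iff_eventually.1 (by simpa using h k)
    obtain ⟨n, hn⟩ := (eventually_all.2 h').exists
    exact hn _ rfl
  choose d hd using fun i => key (c i)
  obtain ⟨k, hk⟩ := key d
  obtain ⟨g, hg, hg'⟩ := exists_seq_of_forall_finset_exists (fun n => d n = k)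
    (fun m n => m < n ∧ c m n = k) (by
      intro s hs
      have h1 : ∀ᶠ n in (hyperfilter ℕ : Filter ℕ), ∀ m ∈ s, m < n ∧ c m n = k := by
        rw [Filter.eventually_all_finset]
        intro m hm
        have h2 : ∀ᶠ n in (hyperfilter ℕ : Filter ℕ), m < n :=
          Filter.Eventually.filter_mono (Nat.hyperfilter_le_atTop) (eventually_gt_atTop m)
        filter_upwards [h2, hd m] with n hn hn'
        exact ⟨hn, hn'.trans (hs m hm)⟩
      obtain ⟨n, hn, hn'⟩ := (hk.and h1).exists
      exact ⟨n, hn, hn'⟩)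
  exact ⟨g, k, fun i j hij => (hg' i j hij).1, fun i j hij => (hg' i j hij).2⟩

/-! ### Indiscernible families over linear orders -/

section Indiscernible

variable {L : FirstOrder.Language.{u, v}} {M : Type w} [L.Structure M]

variable (L) in
/-- The family `a` of tuples indexed by a linear order is (order-)indiscernible. -/
def OrderIndiscernible {I X : Type*} [LinearOrder I] (a : I → X → M) : Prop :=
  ∀ (r : ℕ) (φ : L.Formula (Fin r × X)) (i j : Fin r → I), StrictMono i → StrictMono j →
    (φ.Realize (fun s => a (i s.1) s.2) ↔ φ.Realize (fun s => a (j s.1) s.2))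

variable {I X : Type*} [LinearOrder I] {a : I → X → M}

/-- Two finite index families with the same order pattern, repetitions allowed, factor through a
common finite index set followed by strictly increasing enumerations. -/
theorem OrderIndiscernible.congr_of_pattern (ha : OrderIndiscernible L a) {Y : Type*} [Finite Y]
    {i j : Y → I} (hij : ∀ y z, i y < i z ↔ j y < j z) {R : (Y × X → M) → Prop} (hR : IsDef L R) :
    R (fun s => a (i s.1) s.2) ↔ R (fun s => a (j s.1) s.2) := by
  classical
  have := Fintype.ofFinite Y
  have heq : ∀ y z, i y = i z ↔ j y = j z := fun y z => by
    rw [le_antisymm_iff, le_antisymm_iff, ← not_lt, ← not_lt, hij, hij, not_lt, not_lt]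
  let s := Finset.univ.image i
  let f := s.orderIsoOfFin rfl
  let g : Y → Fin s.card := fun y => f.symm ⟨i y, Finset.mem_image_of_mem _ (Finset.mem_univ y)⟩
  have hfg : ∀ y, (f (g y) : I) = i y := fun y => by simp [g]
  have hsurj : ∀ k : Fin s.card, ∃ y, i y = f k := fun k => by
    obtain ⟨y, _, hy⟩ := Finset.mem_image.1 (f k).2
    exact ⟨y, hy⟩
  choose h hh using hsurj
  obtain ⟨φ, hφ⟩ := hR
  have hi : StrictMono (fun k => i (h k)) := fun k l hkl => by
    simp only [hh]
    exact f.strictMono hkl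
  have hj : StrictMono (fun k => j (h k)) := fun k l hkl => (hij _ _).1 (hi hkl)
  have h1 := ha _ (φ.relabel (Prod.map g id)) _ _ hi hj
  simp only [Formula.realize_relabel, hφ] at h1
  convert h1 using 2
  · funext s
    simp [hh, hfg]
  · funext s
    have : j s.1 = j (h (g s.1)) := (heq _ _).1 (by rw [hh, hfg])
    simp [this]

/-- A sequence obtained by applying fixed terms to members of an indiscernible family, whose
indices follow a fixed order pattern, is indiscernible. -/
theorem OrderIndiscernible.of_terms (ha : OrderIndiscernible L a) {I' Y X' : Type*}
    [LinearOrder I'] [Finite Y] (J : I' → Y → I)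
    (hJ : ∀ (y z : Y) (k l k' l' : I'), (k < l ↔ k' < l') → (k = l ↔ k' = l') →
      (J k y < J l z ↔ J k' y < J l' z))
    (t : X' → L.Term (Y × X)) :
    OrderIndiscernible L fun k x => (t x).realize fun s => a (J k s.1) s.2 := by
  intro r φ i j hi hj
  have h1 := ha.congr_of_pattern (i := fun s : Fin r × Y => J (i s.1) s.2)
    (j := fun s : Fin r × Y => J (j s.1) s.2)
    (fun y z => hJ _ _ _ _ _ _ (hi.lt_iff_lt.trans hj.lt_iff_lt.symm)
      (hi.injective.eq_iff.trans hj.injective.eq_iff.symm))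
    ((IsDef.of_formula (M := M) φ).subst fun s : Fin r × X' =>
      (t s.2).relabel fun y : Y × X => ((s.1, y.1), y.2))
  simp only [Term.realize_relabel] at h1
  exact h1

theorem OrderIndiscernible.isDef_iff (ha : OrderIndiscernible L a) {R : (X → M) → Prop}
    (hR : IsDef L R) (i j : I) : R (a i) ↔ R (a j) :=
  ha.congr_of_pattern (Y := Unit) (i := fun _ : Unit => i) (j := fun _ => j) (fun _ _ => by simp)
    (hR.comp fun x => ((), x))

theorem OrderIndiscernible.isDef_iff_pair (ha : OrderIndiscernible L a)
    {R : (X → M) → (X → M) → Prop}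
    (hR : IsDef L fun v : Bool × X → M => R (fun x => v (false, x)) fun x => v (true, x))
    {i j i' j' : I} (h : i < j) (h' : i' < j') : R (a i) (a j) ↔ R (a i') (a j') :=
  ha.congr_of_pattern (Y := Bool) (i := fun b => cond b j i) (j := fun b => cond b j' i')
    (fun y z => by cases y <;> cases z <;> simp [h, h', h.not_gt, h'.not_gt]) hR

theorem OrderIndiscernible.of_onLanguage {L' : FirstOrder.Language} [L'.Structure M]
    (ϕ : L →ᴸ L') [ϕ.IsExpansionOn M] (ha : OrderIndiscernible L' a) : OrderIndiscernible L a := by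
  intro r φ i j hi hj
  have := ha r (ϕ.onFormula φ) i j hi hj
  simpa only [LHom.realize_onFormula] using this

theorem OrderIndiscernible.reindex (ha : OrderIndiscernible L a) {X' : Type*} (g : X' → X) :
    OrderIndiscernible L fun i => a i ∘ g := by
  intro r φ i j hi hj
  have := ha r (φ.relabel (Prod.map id g)) i j hi hj
  rw [Formula.realize_relabel, Formula.realize_relabel] at this
  exact this

end Indiscernible

/-! ### Cells, Skolem terms, and dependence in one parameter variable -/

section Tame

variable {L : FirstOrder.Language.{u, v}} {M : Type w} [L.Structure M] {α : Type*}

theorem mem_closure_range_iff {a : α → M} {x : M} :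
    x ∈ Substructure.closure L (Set.range a) ↔ ∃ t : L.Term α, t.realize a = x := by
  rw [Substructure.mem_closure_iff_exists_term]
  constructor
  · rintro ⟨t, rfl⟩
    choose g hg using fun s : Set.range a => s.2
    refine ⟨t.relabel g, ?_⟩
    rw [Term.realize_relabel]
    congr 1
    funext s
    exact hg s
  · rintro ⟨t, rfl⟩
    refine ⟨t.relabel fun i => ⟨a i, i, rfl⟩, ?_⟩
    rw [Term.realize_relabel]
    rfl

theorem IsDef.const (p : Prop) : IsDef L fun _ : α → M => p := by
  by_cases hp : p
  · exact ⟨⊤, fun v => by simp [hp]⟩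
  · exact ⟨⊥, fun v => by simp [hp]⟩

variable (L M) in
/-- Every substructure of `M` is an elementary substructure. -/
def SubstructuresElementary : Prop := ∀ N : L.Substructure M, N.IsElementary

/-- Definable Skolem functions, given by terms. -/
theorem SubstructuresElementary.exists_term (h : SubstructuresElementary L M) {γ : Type*} [Finite γ]
    {R : (α ⊕ γ → M) → Prop} (hR : IsDef L R) {a : α → M} (ha : ∃ e, R (Sum.elim a e)) :
    ∃ t : γ → L.Term α, R (Sum.elim a fun k => (t k).realize a) := by
  obtain ⟨φ, hφ⟩ := hR
  let N : L.ElementarySubstructure M := ⟨_, h (Substructure.closure L (Set.range a))⟩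
  let a' : α → N := fun i => ⟨a i, Substructure.subset_closure ⟨i, rfl⟩⟩
  have h1 : (φ.iExs γ).Realize (N.subtype ∘ a') := by
    rw [Formula.realize_iExs]
    exact ha.imp fun e he => (hφ _).2 he
  rw [ElementaryEmbedding.map_formula, Formula.realize_iExs] at h1
  obtain ⟨e, he⟩ := h1
  choose t ht using fun k => mem_closure_range_iff.1 (show ((e k : N) : M) ∈
    Substructure.closure L (Set.range a) from (e k).2)
  refine ⟨t, ?_⟩
  rw [← ElementaryEmbedding.map_formula N.subtype, hφ] at he
  convert he using 1
  funext i
  rcases i with i | i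
  · rfl
  · exact ht i

/-- Definable closure is generated by terms: the Skolem term for a relation with a unique solution
must produce that solution. -/
theorem SubstructuresElementary.mem_closure_of_unique (h : SubstructuresElementary L M)
    {R : (α ⊕ Unit → M) → Prop} (hR : IsDef L R) {a : α → M} {c : M}
    (hc : R (Sum.elim a fun _ => c)) (hc' : ∀ x, R (Sum.elim a fun _ => x) → x = c) :
    c ∈ Substructure.closure L (Set.range a) := by
  obtain ⟨t, ht⟩ := h.exists_term hR ⟨_, hc⟩
  exact mem_closure_range_iff.2 ⟨t (), hc' _ ht⟩

variable [LinearOrder M]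

/-- `y` and `y'` have the same position with respect to the points `E k`. -/
def SameCell {ι : Type*} (E : ι → M) (y y' : M) : Prop :=
  ∀ k, ((E k < y) ↔ (E k < y')) ∧ ((y < E k) ↔ (y' < E k))

theorem SameCell.of_between {ι : Type*} {E : ι → M} {c x y z : M} (hx : SameCell E c x)
    (hy : SameCell E c y) (h : x ≤ z) (h' : z ≤ y) : SameCell E c z := fun k =>
  ⟨⟨fun hk => ((hx k).1.1 hk).trans_le h, fun hk => (hy k).1.2 (hk.trans_le h')⟩,
    ⟨fun hk => h'.trans_lt ((hy k).2.1 hk), fun hk => (hx k).2.2 (h.trans_lt hk)⟩⟩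

variable (L M) in
/-- A linearly ordered structure in which the order is definable, every set that is definable with
parameters is a union of cells of a finite set, and substructures are elementary. -/
structure Tame : Prop where
  lt_def : IsDef L fun v : Fin 2 → M => v 0 < v 1
  cells_set : ∀ X : Set M, (Set.univ : Set M).Definable₁ L X →
    ∃ (n : ℕ) (E : Fin n → M), ∀ y y', SameCell E y y' → (y ∈ X ↔ y' ∈ X)
  elementary : SubstructuresElementary L M

namespace Tame

variable (hM : Tame L M)

include hM

theorem lt (s t : L.Term α) : IsDef L fun v : α → M => s.realize v < t.realize v :=
  hM.lt_def.subst ![s, t]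

theorem lt_var (x y : α) : IsDef L fun v : α → M => v x < v y :=
  hM.lt (Term.var x) (Term.var y)

theorem cells {R : (α ⊕ Unit → M) → Prop} (hR : IsDef L R) (a : α → M) :
    ∃ (n : ℕ) (E : Fin n → M), ∀ y y', SameCell E y y' →
      (R (Sum.elim a fun _ => y) ↔ R (Sum.elim a fun _ => y')) := by
  obtain ⟨φ, hφ⟩ := hR
  refine hM.cells_set {y | R (Sum.elim a fun _ => y)}
    ⟨((L.lhomWithConstants (Set.univ : Set M)).onFormula φ).subst (Sum.elim
      (fun i => ((L.con (⟨a i, trivial⟩ : (Set.univ : Set M))).term : L[[(Set.univ : Set M)]].Term (Fin 1)))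
      fun _ => Term.var 0), ?_⟩
  ext v
  have := (BoundedFormula.realize_subst (φ := (L.lhomWithConstants (Set.univ : Set M)).onFormula φ)
    (tf := Sum.elim
      (fun i => ((L.con (⟨a i, trivial⟩ : (Set.univ : Set M))).term : L[[(Set.univ : Set M)]].Term (Fin 1)))
      fun _ => Term.var 0) (v := v) (xs := default))
  refine Iff.trans ?_ this.symm
  refine Iff.trans ?_ (LHom.realize_onFormula _ φ).symm
  rw [hφ]
  refine iff_of_eq (congrArg R ?_)
  funext i
  rcases i with i | i
  · simp
  · rfl

theorem isDef_sameCell {ι : Type*} [Finite ι] (t : ι → L.Term α) (x y : α) :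
    IsDef L fun v : α → M => SameCell (fun k => (t k).realize v) (v x) (v y) :=
  IsDef.forall_finite fun k =>
    ((hM.lt (t k) (Term.var x)).iff (hM.lt (t k) (Term.var y))).and
      ((hM.lt (Term.var x) (t k)).iff (hM.lt (Term.var y) (t k)))

/-- To be in the cell of a given point is definable from the points that determine the cells. -/
theorem isDef_sameCell_const {ι : Type*} [Finite ι] (t : ι → L.Term α) (x : α) (E : ι → M) (c : M) :
    IsDef L fun v : α → M => ∀ k, ((E k < c) ↔ ((t k).realize v < v x)) ∧
      ((c < E k) ↔ (v x < (t k).realize v)) :=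
  IsDef.forall_finite fun k =>
    ((IsDef.const _).iff (hM.lt (t k) (Term.var x))).and
      ((IsDef.const _).iff (hM.lt (Term.var x) (t k)))

theorem isDef_cells {R : (α ⊕ Unit → M) → Prop} (hR : IsDef L R) {ι : Type*} [Finite ι]
    (t : ι → L.Term α) :
    IsDef L fun v : α → M => ∀ y y', SameCell (fun k => (t k).realize v) y y' →
      (R (Sum.elim v fun _ => y) ↔ R (Sum.elim v fun _ => y')) := by
  refine IsDef.all (Q := fun v y => ∀ y', SameCell (fun k => (t k).realize v) y y' →
      (R (Sum.elim v fun _ => y) ↔ R (Sum.elim v fun _ => y'))) ?_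
  refine IsDef.all (Q := fun v y' => SameCell (fun k => (t k).realize (v ∘ Sum.inl))
    (v (Sum.inr ())) y' → (R (Sum.elim (v ∘ Sum.inl) fun _ => v (Sum.inr ())) ↔
      R (Sum.elim (v ∘ Sum.inl) fun _ => y'))) ?_
  refine IsDef.imp ?_ (IsDef.iff ?_ ?_)
  · refine (hM.isDef_sameCell (fun k => (t k).relabel (Sum.inl ∘ Sum.inl))
      (Sum.inl (Sum.inr ()) : (α ⊕ Unit) ⊕ Unit) (Sum.inr ())).congr fun v => ?_
    simp only [Term.realize_relabel]
    rfl
  · refine (hR.comp (Sum.elim (Sum.inl ∘ Sum.inl) fun _ => Sum.inl (Sum.inr ()))).congr fun v => ?_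
    refine iff_of_eq (congrArg R ?_)
    funext i; rcases i with i | i <;> rfl
  · refine (hR.comp (Sum.elim (Sum.inl ∘ Sum.inl) fun _ => Sum.inr ())).congr fun v => ?_
    refine iff_of_eq (congrArg R ?_)
    funext i; rcases i with i | i <;> rfl

/-- That some finite tuple cuts out suitable cells is a definable property of `a`, so Skolem terms
supply such a tuple from `a`. The same terms then serve every member of an indiscernible sequence.
-/
theorem cells_term {R : (α ⊕ Unit → M) → Prop} (hR : IsDef L R) (a : α → M) :
    ∃ (n : ℕ) (t : Fin n → L.Term α), ∀ y y', SameCell (fun k => (t k).realize a) y y' →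
      (R (Sum.elim a fun _ => y) ↔ R (Sum.elim a fun _ => y')) := by
  obtain ⟨n, E, hE⟩ := hM.cells hR a
  have h1 := hM.isDef_cells (α := α ⊕ Fin n) (hR.comp (Sum.map Sum.inl id)) fun k : Fin n =>
    Term.var (Sum.inr k)
  have h2 : ∀ (e : Fin n → M) (y : M), (Sum.elim (Sum.elim a e) fun _ => y) ∘ Sum.map Sum.inl id =
      Sum.elim a fun _ : Unit => y := fun e y => by
    funext i; rcases i with i | i <;> rfl
  obtain ⟨t, ht⟩ := hM.elementary.exists_term h1 (a := a) ⟨E, by simpa [h2] using hE⟩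
  exact ⟨n, t, by simpa [h2] using ht⟩

/-- The one-variable case of the dependence of `L`-formulas. -/
theorem eventually_const_one {X : Type*} {a : ℕ → X → M} (ha : OrderIndiscernible L a)
    {R : (X ⊕ Unit → M) → Prop} (hR : IsDef L R) (b : M) :
    (∀ᶠ i in atTop, R (Sum.elim (a i) fun _ => b)) ∨
      ∀ᶠ i in atTop, ¬ R (Sum.elim (a i) fun _ => b) := by
  obtain ⟨n, t, ht⟩ := hM.cells_term hR (a 0)
  replace ht : ∀ i, ∀ y y', SameCell (fun k => (t k).realize (a i)) y y' →
      (R (Sum.elim (a i) fun _ => y) ↔ R (Sum.elim (a i) fun _ => y')) := fun i =>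
    (ha.isDef_iff (hM.isDef_cells hR t) 0 i).1 ht
  have hmono : ∀ p : ℕ → Prop, (∀ i j, i < j → p i → p j) → ∃ N, ∀ i, N ≤ i → (p N ↔ p i) := by
    intro p hp
    by_cases h : ∃ N, p N
    · obtain ⟨N, hN⟩ := h
      refine ⟨N, fun i hi => iff_of_true hN ?_⟩
      rcases hi.eq_or_lt with rfl | hi
      · exact hN
      · exact hp _ _ hi hN
    · push Not at h
      exact ⟨0, fun i _ => iff_of_false (h 0) (h i)⟩
  have hanti : ∀ p : ℕ → Prop, (∀ i j, i < j → p j → p i) → ∃ N, ∀ i, N ≤ i → (p N ↔ p i) := by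
    intro p hp
    obtain ⟨N, hN⟩ := hmono (fun i => ¬ p i) fun i j hij hi hj => hi (hp i j hij hj)
    exact ⟨N, fun i hi => not_iff_not.1 (hN i hi)⟩
  -- By indiscernibility the sequence `(t k)(a i)` is monotone in `i`, so it crosses `b` at most
  -- once in each of the two senses.
  have key : ∀ k, ∃ N, ∀ i, N ≤ i →
      (((t k).realize (a N) < b ↔ (t k).realize (a i) < b) ∧
        (b < (t k).realize (a N) ↔ b < (t k).realize (a i))) := by
    intro k
    have hdef : IsDef L fun v : Bool × X → M =>
        (t k).realize (fun x => v (false, x)) < (t k).realize (fun x => v (true, x)) := by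
      refine (hM.lt ((t k).relabel fun x => (false, x)) ((t k).relabel fun x => (true, x))).congr ?_
      intro v
      simp only [Term.realize_relabel]
      rfl
    have hdef' : IsDef L fun v : Bool × X → M =>
        (t k).realize (fun x => v (true, x)) < (t k).realize (fun x => v (false, x)) := by
      refine (hM.lt ((t k).relabel fun x => (true, x)) ((t k).relabel fun x => (false, x))).congr ?_
      intro v
      simp only [Term.realize_relabel]
      rfl
    have h1 : ∀ {i j : ℕ}, i < j → ((t k).realize (a i) < (t k).realize (a j) ↔
        (t k).realize (a 0) < (t k).realize (a 1)) := fun {i j} hij =>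
      ha.isDef_iff_pair (R := fun v w => (t k).realize v < (t k).realize w) hdef hij zero_lt_one
    have h2 : ∀ {i j : ℕ}, i < j → ((t k).realize (a j) < (t k).realize (a i) ↔
        (t k).realize (a 1) < (t k).realize (a 0)) := fun {i j} hij =>
      ha.isDef_iff_pair (R := fun v w => (t k).realize w < (t k).realize v) hdef' hij zero_lt_one
    have comb : ∀ {p q : ℕ → Prop}, (∃ N, ∀ i, N ≤ i → (p N ↔ p i)) →
        (∃ N, ∀ i, N ≤ i → (q N ↔ q i)) → ∃ N, ∀ i, N ≤ i → ((p N ↔ p i) ∧ (q N ↔ q i)) := by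
      rintro p q ⟨N, hN⟩ ⟨N', hN'⟩
      refine ⟨max N N', fun i hi => ⟨?_, ?_⟩⟩
      · rw [← hN _ (le_max_left _ _), ← hN _ ((le_max_left _ _).trans hi)]
      · rw [← hN' _ (le_max_right _ _), ← hN' _ ((le_max_right _ _).trans hi)]
    rcases le_total ((t k).realize (a 0)) ((t k).realize (a 1)) with h | h
    · have h3 : ∀ i j, i < j → (t k).realize (a i) ≤ (t k).realize (a j) := fun i j hij =>
        not_lt.1 ((h2 hij).not.2 h.not_gt)
      exact comb (hanti _ fun i j hij hj => (h3 i j hij).trans_lt hj)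
        (hmono _ fun i j hij hj => hj.trans_le (h3 i j hij))
    · have h3 : ∀ i j, i < j → (t k).realize (a j) ≤ (t k).realize (a i) := fun i j hij =>
        not_lt.1 ((h1 hij).not.2 h.not_gt)
      exact comb (hmono _ fun i j hij hj => (h3 i j hij).trans_lt hj)
        (hanti _ fun i j hij hj => hj.trans_le (h3 i j hij))
  choose N hN using key
  obtain ⟨m, hm⟩ : ∃ m, ∀ k, N k ≤ m := ⟨Finset.univ.sup N, fun k =>
    Finset.le_sup (f := N) (Finset.mem_univ k)⟩
  have hpat : ∀ i, m ≤ i → ∀ k,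
      (((t k).realize (a m) < b ↔ (t k).realize (a i) < b) ∧
        (b < (t k).realize (a m) ↔ b < (t k).realize (a i))) := fun i hi k => by
    have h1 := hN k m (hm k)
    have h2 := hN k i ((hm k).trans hi)
    exact ⟨h1.1.symm.trans h2.1, h1.2.symm.trans h2.2⟩
  -- From `m` on, `b` can be replaced by any point of its cell, and the cell is described by the
  -- frozen position pattern alone. This gives a condition on `a i` without parameters, constant by
  -- indiscernibility.
  let P : (X → M) → Prop := fun v => ∃ y,
    (∀ k, (((t k).realize (a m) < b) ↔ ((t k).realize v < y)) ∧
      ((b < (t k).realize (a m)) ↔ (y < (t k).realize v))) ∧ R (Sum.elim v fun _ => y)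
  have hP : IsDef L P := by
    refine IsDef.ex (Q := fun v y => (∀ k, (((t k).realize (a m) < b) ↔ ((t k).realize v < y)) ∧
      ((b < (t k).realize (a m)) ↔ (y < (t k).realize v))) ∧ R (Sum.elim v fun _ => y)) ?_
    refine IsDef.and ?_ ?_
    · refine (hM.isDef_sameCell_const (fun k => (t k).relabel Sum.inl) (Sum.inr () : X ⊕ Unit)
        (fun k => (t k).realize (a m)) b).congr fun v => ?_
      simp only [Term.realize_relabel]
    · refine hR.congr fun v => iff_of_eq (congrArg R ?_)
      funext i; rcases i with i | i <;> rfl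
  have hRP : ∀ i, m ≤ i → (R (Sum.elim (a i) fun _ => b) ↔ P (a i)) := by
    intro i hi
    refine ⟨fun h => ⟨b, hpat i hi, h⟩, fun ⟨y, hy, h⟩ => (ht i y b ?_).1 h⟩
    intro k
    exact ⟨(hy k).1.symm.trans (hpat i hi k).1, (hy k).2.symm.trans (hpat i hi k).2⟩
  by_cases h : P (a 0)
  · left
    filter_upwards [eventually_ge_atTop m] with i hi
    exact (hRP i hi).2 ((ha.isDef_iff hP 0 i).1 h)
  · right
    filter_upwards [eventually_ge_atTop m] with i hi
    exact fun h' => h ((ha.isDef_iff hP 0 i).2 ((hRP i hi).1 h'))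

end Tame

end Tame

/-! ### Definable connectedness and the exchange property -/

section Exchange

/-- Definable connectedness: a union of cells of a finite set that is open and closed along
`[y, y']` and contains `y` also contains `y'`. -/
theorem mem_of_locally_const {M : Type*} [LinearOrder M] {n : ℕ} {E : Fin n → M} {W : M → Prop}
    (hE : ∀ x x', SameCell E x x' → (W x ↔ W x')) {y y' : M} (hyy : y ≤ y') (hy : W y)
    (hloc : ∀ x, y ≤ x → x ≤ y' → ∃ u v, u < x ∧ x < v ∧ ∀ z, u ≤ z → z ≤ v → (W z ↔ W x)) :
    W y' := by
  classical
  by_contra hy'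
  let F : Finset M := insert y (insert y' (Finset.univ.image E))
  have hyF : y ∈ F := by simp [F]
  have hyF' : y' ∈ F := by simp [F]
  have hEF : ∀ k, E k ∈ F := fun k => by simp [F]
  have hne : (F.filter fun x => (y ≤ x ∧ x ≤ y') ∧ W x).Nonempty :=
    ⟨y, Finset.mem_filter.2 ⟨hyF, ⟨le_rfl, hyy⟩, hy⟩⟩
  -- `e` is the last marked point at which `W` holds and `e2` is the next marked point. No endpoint
  -- lies strictly between them, so the open gap is a single cell, yet `W` holds next to `e` and
  -- fails next to `e2`.
  obtain ⟨e, he, hmax⟩ := Finset.exists_max_image _ id hne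
  simp only [Finset.mem_filter, id, and_imp] at he hmax
  obtain ⟨_, ⟨hye, hey'⟩, hWe⟩ := he
  have hlt : e < y' := lt_of_le_of_ne hey' fun h => hy' (h ▸ hWe)
  have hne2 : (F.filter fun x => e < x ∧ x ≤ y').Nonempty :=
    ⟨y', Finset.mem_filter.2 ⟨hyF', hlt, le_rfl⟩⟩
  obtain ⟨e2, he2, hmin⟩ := Finset.exists_min_image _ id hne2
  simp only [Finset.mem_filter, id, and_imp] at he2 hmin
  obtain ⟨he2F, hee2, he2y'⟩ := he2
  have hWe2 : ¬ W e2 := fun h =>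
    (hmax e2 he2F (hye.trans hee2.le) he2y' h).not_gt hee2
  obtain ⟨u, v, hu, hv, huv⟩ := hloc e hye hey'
  have hve2 : v < e2 := by
    by_contra h
    exact hWe2 ((huv e2 (hu.trans hee2).le (not_lt.1 h)).2 hWe)
  obtain ⟨u2, v2, hu2, hv2, huv2⟩ := hloc e2 (hye.trans hee2.le) he2y'
  have heu2 : e < u2 := by
    by_contra h
    exact hWe2 ((huv2 e (not_lt.1 h) (hee2.trans hv2).le).1 hWe)
  have hgap : ∀ k, E k ≤ e ∨ e2 ≤ E k := fun k => by
    by_contra! h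
    exact (hmin (E k) (hEF k) h.1 (h.2.le.trans he2y')).not_gt h.2
  have hcell : SameCell E v u2 := by
    intro k
    rcases hgap k with h | h
    · exact ⟨iff_of_true (h.trans_lt hv) (h.trans_lt heu2),
        iff_of_false (h.trans hv.le).not_gt (h.trans heu2.le).not_gt⟩
    · exact ⟨iff_of_false (hve2.le.trans h).not_gt (hu2.le.trans h).not_gt,
        iff_of_true (hve2.trans_le h) (hu2.trans_le h)⟩
  have h1 : W v := (huv v (hu.trans hv).le le_rfl).2 hWe
  exact hWe2 ((huv2 u2 le_rfl (hu2.trans hv2).le).1 ((hE _ _ hcell).1 h1))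

variable {L : FirstOrder.Language.{u, v}} {M : Type w} [L.Structure M] {α : Type*}

variable [LinearOrder M]

namespace Tame

variable (hM : Tame L M)

include hM

/-- Otherwise `c` would be the unique `r`-extremal point of its cell, hence definable from `a`. With
`r` equal to `<` and to `>` this gives points of the cell on both sides of `c`. -/
theorem exists_mem_cell_of_notMem_closure {r : M → M → Prop} [Std.Trichotomous r]
    (hr : IsDef L fun v : Fin 2 → M => r (v 0) (v 1)) {ι : Type*} [Finite ι] (t : ι → L.Term α)
    {a : α → M} {c : M} (hc : c ∉ Substructure.closure L (Set.range a)) :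
    ∃ u, r u c ∧ SameCell (fun k => (t k).realize a) c u := by
  by_contra! hu
  refine hc (hM.elementary.mem_closure_of_unique (R := fun v : α ⊕ Unit → M =>
    (∀ k, (((t k).realize a < c) ↔ ((t k).realize (v ∘ Sum.inl) < v (Sum.inr ()))) ∧
      ((c < (t k).realize a) ↔ (v (Sum.inr ()) < (t k).realize (v ∘ Sum.inl)))) ∧
    ∀ z, r z (v (Sum.inr ())) → ¬ ∀ k, (((t k).realize a < c) ↔ ((t k).realize (v ∘ Sum.inl) < z)) ∧
      ((c < (t k).realize a) ↔ (z < (t k).realize (v ∘ Sum.inl)))) ?_ ?_ ?_)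
  · refine IsDef.and ?_ ?_
    · refine (hM.isDef_sameCell_const (fun k => (t k).relabel Sum.inl) (Sum.inr () : α ⊕ Unit)
        (fun k => (t k).realize a) c).congr fun v => ?_
      simp only [Term.realize_relabel]
    · refine IsDef.all (Q := fun (v : α ⊕ Unit → M) z => r z (v (Sum.inr ())) →
        ¬ ∀ k, (((t k).realize a < c) ↔ ((t k).realize (v ∘ Sum.inl) < z)) ∧
        ((c < (t k).realize a) ↔ (z < (t k).realize (v ∘ Sum.inl)))) (IsDef.imp ?_ (IsDef.not ?_))
      · exact hr.subst ![Term.var (Sum.inr ()), Term.var (Sum.inl (Sum.inr ()))]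
      · refine (hM.isDef_sameCell_const (fun k => (t k).relabel (Sum.inl ∘ Sum.inl))
          (Sum.inr () : (α ⊕ Unit) ⊕ Unit) (fun k => (t k).realize a) c).congr fun v => ?_
        simp only [Term.realize_relabel]
        rfl
  · exact ⟨fun k => ⟨Iff.rfl, Iff.rfl⟩, fun z hz hz' => hu z hz hz'⟩
  · rintro x ⟨hx, hx'⟩
    by_contra hne
    rcases Std.Trichotomous.rel_or_eq_or_rel_swap (r := r) (a := c) (b := x) with h | h | h
    · exact hx' c h fun k => ⟨Iff.rfl, Iff.rfl⟩
    · exact hne h.symm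
    · exact hu x h hx

/-- The exchange property of the closure operator. -/
theorem exchange {A : Set M} {b c : M} (hb : b ∈ Substructure.closure L (insert c A))
    (hbA : b ∉ Substructure.closure L A) : c ∈ Substructure.closure L (insert b A) := by
  have hrange : ∀ x : M, Set.range (Sum.elim (Subtype.val : A → M) fun _ : Unit => x) =
      insert x A := by
    intro x
    ext z
    simp [eq_comm]
  have hval : Set.range (Subtype.val : A → M) = A := Subtype.range_val
  by_contra hcA
  rw [← hrange, mem_closure_range_iff] at hb
  obtain ⟨t, rfl⟩ := hb
  set h : M → M := fun x => t.realize (Sum.elim (Subtype.val : A → M) fun _ => x) with hh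
  change h c ∉ _ at hbA
  change c ∉ Substructure.closure L (insert (h c) A) at hcA
  have hterm : ∀ s s' : L.Term ((A ⊕ Unit) ⊕ Unit), IsDef L fun v : (A ⊕ Unit) ⊕ Unit → M =>
      s.realize v = s'.realize v := fun s s' =>
    (IsDef.eq (0 : Fin 2) 1).subst ![s, s']
  have hfib : IsDef L fun v : (A ⊕ Unit) ⊕ Unit → M =>
      t.realize (Sum.elim (fun i => v (Sum.inl (Sum.inl i))) fun _ => v (Sum.inr ())) =
        v (Sum.inl (Sum.inr ())) := by
    refine (hterm (t.relabel (Sum.map Sum.inl id)) (Term.var (Sum.inl (Sum.inr ())))).congr ?_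
    intro v
    simp only [Term.realize_relabel, Term.realize_var]
    refine iff_of_eq (congrArg (fun x => t.realize x = _) ?_)
    funext i; rcases i with i | i <;> rfl
  obtain ⟨n, s, hs⟩ := hM.cells_term hfib (Sum.elim (Subtype.val : A → M) fun _ => h c)
  have hs' : ∀ z, SameCell (fun k => (s k).realize
      (Sum.elim (Subtype.val : A → M) fun _ => h c)) c z → h z = h c := fun z hz =>
    (hs c z hz).1 rfl
  have hcA' := hcA
  rw [← hrange] at hcA'
  -- Since `c` is not in the closure of `A` and `h c`, it is interior to its cell for the fibre of
  -- `h` over `h c`. Thus `h` is constant on an interval around `c`.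
  obtain ⟨u, hu, hu'⟩ := hM.exists_mem_cell_of_notMem_closure (r := (· < ·)) hM.lt_def s hcA'
  obtain ⟨v, hv, hv'⟩ := hM.exists_mem_cell_of_notMem_closure (r := (· > ·))
    (hM.lt_var 1 0) s hcA'
  let D : M → Prop := fun x => ∃ u v, u < x ∧ x < v ∧ ∀ z, u ≤ z → z ≤ v → h z = h x
  have hDc : D c := ⟨u, v, hu, hv, fun z hz hz' => hs' z (hu'.of_between hv' hz hz')⟩
  have hDdef : IsDef L fun v : A ⊕ Unit → M => ∃ u w, u < v (Sum.inr ()) ∧ v (Sum.inr ()) < w ∧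
      ∀ z, ¬ z < u → ¬ w < z → t.realize (Sum.elim (fun i => v (Sum.inl i)) fun _ => z) =
        t.realize (Sum.elim (fun i => v (Sum.inl i)) fun _ => v (Sum.inr ())) := by
    refine IsDef.ex (Q := fun v u => ∃ w, u < v (Sum.inr ()) ∧ v (Sum.inr ()) < w ∧
      ∀ z, ¬ z < u → ¬ w < z → t.realize (Sum.elim (fun i => v (Sum.inl i)) fun _ => z) =
        t.realize (Sum.elim (fun i => v (Sum.inl i)) fun _ => v (Sum.inr ()))) ?_
    refine IsDef.ex (Q := fun (v : (A ⊕ Unit) ⊕ Unit → M) w => v (Sum.inr ()) < v (Sum.inl (Sum.inr ())) ∧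
      v (Sum.inl (Sum.inr ())) < w ∧
      ∀ z, ¬ z < v (Sum.inr ()) → ¬ w < z →
        t.realize (Sum.elim (fun i => v (Sum.inl (Sum.inl i))) fun _ => z) =
        t.realize (Sum.elim (fun i => v (Sum.inl (Sum.inl i))) fun _ => v (Sum.inl (Sum.inr ())))) ?_
    refine (hM.lt_var _ _).and ((hM.lt_var _ _).and ?_)
    refine IsDef.all (Q := fun (v : ((A ⊕ Unit) ⊕ Unit) ⊕ Unit → M) z =>
        ¬ z < v (Sum.inl (Sum.inr ())) → ¬ v (Sum.inr ()) < z →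
        t.realize (Sum.elim (fun i => v (Sum.inl (Sum.inl (Sum.inl i)))) fun _ => z) =
        t.realize (Sum.elim (fun i => v (Sum.inl (Sum.inl (Sum.inl i))))
          fun _ => v (Sum.inl (Sum.inl (Sum.inr ()))))) ?_
    refine (hM.lt_var _ _).not.imp ((hM.lt_var _ _).not.imp ?_)
    refine ((IsDef.eq (0 : Fin 2) 1).subst ![t.relabel (Sum.map (Sum.inl ∘ Sum.inl ∘ Sum.inl) id),
      t.relabel (Sum.elim (Sum.inl ∘ Sum.inl ∘ Sum.inl ∘ Sum.inl)
        fun _ => (Sum.inl (Sum.inl (Sum.inl (Sum.inr ())))))]).congr fun v => ?_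
    simp only [Matrix.cons_val_zero, Matrix.cons_val_one, Term.realize_relabel]
    refine iff_of_eq (congrArg₂ (fun x y => t.realize x = t.realize y) ?_ ?_) <;>
    · funext i; rcases i with i | i <;> rfl
  -- Local constancy is definable over `A` alone, so it holds on the whole cell of `c` cut out by
  -- points of the closure of `A`.
  obtain ⟨n', s', hD⟩ := hM.cells_term hDdef (Subtype.val : A → M)
  have hD' : ∀ z, SameCell (fun k => (s' k).realize (Subtype.val : A → M)) c z → D z := by
    intro z hz
    have h1 := (hD c z hz).1 (by
      obtain ⟨u, w, h1, h2, h3⟩ := hDc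
      exact ⟨u, w, h1, h2, fun z hz hz' => h3 z (not_lt.1 hz) (not_lt.1 hz')⟩)
    obtain ⟨u, w, h1, h2, h3⟩ := h1
    exact ⟨u, w, h1, h2, fun z hz hz' => h3 z (not_lt.2 hz) (not_lt.2 hz')⟩
  -- A Skolem term finds a point `y` of the same cell in the closure of `A`. By connectedness `h` is
  -- constant on the cell, so `h c = h y` lies in the closure of `A`, a contradiction.
  obtain ⟨q, hq⟩ := hM.elementary.exists_term (γ := Unit)
    (hM.isDef_sameCell_const (fun k => (s' k).relabel Sum.inl) (Sum.inr () : A ⊕ Unit)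
      (fun k => (s' k).realize (Subtype.val : A → M)) c) (a := Subtype.val)
    ⟨fun _ => c, fun k => by simp only [Term.realize_relabel]; exact ⟨Iff.rfl, Iff.rfl⟩⟩
  simp only [Term.realize_relabel] at hq
  change SameCell (fun k => (s' k).realize (Subtype.val : A → M)) c ((q ()).realize Subtype.val) at hq
  set y := (q ()).realize (Subtype.val : A → M) with hy
  have hconn : ∀ x x', SameCell (fun k => (s' k).realize (Subtype.val : A → M)) c x →
      SameCell (fun k => (s' k).realize (Subtype.val : A → M)) c x' → x ≤ x' → h x' = h x := by
    intro x x' hx hx' hxx'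
    obtain ⟨m, E, hE⟩ := hM.cells hfib (Sum.elim (Subtype.val : A → M) fun _ => h x)
    refine mem_of_locally_const (W := fun z => h z = h x) hE hxx' rfl fun z hz hz' => ?_
    obtain ⟨u, w, h1, h2, h3⟩ := hD' z (hx.of_between hx' hz hz')
    exact ⟨u, w, h1, h2, fun z' hz hz' => by rw [h3 z' hz hz']⟩
  have hyc : h c = h y := by
    rcases le_total y c with hle | hle
    · exact hconn _ _ hq (fun k => ⟨Iff.rfl, Iff.rfl⟩) hle
    · exact (hconn _ _ (fun k => ⟨Iff.rfl, Iff.rfl⟩) hq hle).symm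
  refine hbA ?_
  rw [hyc, ← hval, mem_closure_range_iff]
  refine ⟨t.subst (Sum.elim Term.var q), ?_⟩
  rw [Term.realize_subst]
  refine congrArg t.realize ?_
  funext i; rcases i with i | i <;> rfl

/-- If `Y` has finite rank over `X`, then it has a finite basis over `X`. -/
theorem exists_finset_subset_closure (D : Finset M) {X Y : Set M}
    (hY : Y ⊆ Substructure.closure L (X ∪ D)) :
    ∃ D' : Finset M, (D' : Set M) ⊆ Y ∧ Y ⊆ Substructure.closure L (X ∪ D') := by
  classical
  induction D using Finset.induction_on generalizing X with
  | empty => exact ⟨∅, by simp, hY⟩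
  | insert d D hd ih =>
    obtain ⟨D', hD', hYD'⟩ := ih (X := insert d X) (by
      rwa [Finset.coe_insert, Set.union_insert, ← Set.insert_union] at hY)
    by_cases h : Y ⊆ Substructure.closure L (X ∪ D')
    · exact ⟨D', hD', h⟩
    · obtain ⟨y, hy, hy'⟩ := Set.not_subset.1 h
      rw [Set.insert_union] at hYD'
      -- Exchange replaces the external generator `d` by the element `y` of `Y`.
      have h1 := hM.exchange (hYD' hy) hy'
      refine ⟨insert y D', by simp [Set.insert_subset_iff, hy, hD'], hYD'.trans ?_⟩
      rw [Finset.coe_insert, Set.union_insert]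
      exact (Substructure.closure_le (L := L)).2 (Set.insert_subset h1
        ((Set.subset_insert _ _).trans Substructure.subset_closure))

end Tame

end Exchange

/-! ### From o-minimality to tameness -/

section OMinimal

variable {L : FirstOrder.Language.{u, v}} {M : Type w} [L.Structure M]

theorem HasUniversalAxiomatization.models_substructure {T : L.Theory}
    (hT : HasUniversalAxiomatization T) (hM : M ⊨ T) (N : L.Substructure M) [Nonempty N] :
    N ⊨ T := by
  obtain ⟨U, hU, hUT⟩ := hT
  have : Nonempty M := ⟨((Classical.arbitrary N : N) : M)⟩
  have hMU : M ⊨ U := U.model_iff.2 fun φ hφ =>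
    ((hUT φ).1 (Theory.models_sentence_of_mem hφ)).realize_sentence M
  have hNU : N ⊨ U := Substructure.models_of_isUniversal N U
  exact T.model_iff.2 fun φ hφ =>
    ((hUT φ).2 (Theory.models_sentence_of_mem hφ)).realize_sentence N

/-- Universal axioms pass to substructures, so every substructure is a model of `T`; quantifier
elimination then makes the inclusion elementary. -/
theorem SubstructuresElementary.of_hasQE {T : L.Theory} (hqe : HasQE T)
    (hT : HasUniversalAxiomatization T) (hM : M ⊨ T) (hne : ∀ N : L.Substructure M, Nonempty N) :
    SubstructuresElementary L M := by
  intro N n φ x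
  have := hne N
  have : Nonempty M := ⟨((Classical.arbitrary N : N) : M)⟩
  have hN : N ⊨ T := hT.models_substructure hM N
  obtain ⟨ψ, hψ, h⟩ := hqe n φ
  rw [h.realize_iff, h.realize_iff]
  have := hψ.realize_embedding N.subtype (v := x) (xs := default)
  rw [Formula.Realize, Formula.Realize, ← this]
  congr!

theorem IsPointOrInterval.exists_cells [LinearOrder M] {I : Set M}
    (hI : IsPointOrInterval (· < ·) I) :
    ∃ E : Finset M, ∀ y y', SameCell (Subtype.val : E → M) y y' → (y ∈ I ↔ y' ∈ I) := by
  classical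
  rcases hI with a | ⟨a, b⟩ | a | b
  · refine ⟨{a}, fun y y' h => ?_⟩
    have := h ⟨a, by simp⟩
    simp only [Set.mem_singleton_iff, le_antisymm_iff, ← not_lt, this]
  · refine ⟨{a, b}, fun y y' h => ?_⟩
    have h1 := (h ⟨a, by simp⟩).1
    have h2 := (h ⟨b, by simp⟩).2
    exact and_congr h1 h2
  · exact ⟨{a}, fun y y' h => (h ⟨a, by simp⟩).1⟩
  · exact ⟨{b}, fun y y' h => (h ⟨b, by simp⟩).2⟩
  · exact ⟨∅, fun y y' _ => Iff.rfl⟩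

theorem exists_cells_sUnion [LinearOrder M] {F : Set (Set M)} (hF : F.Finite)
    (hI : ∀ I ∈ F, IsPointOrInterval (· < ·) I) :
    ∃ (n : ℕ) (E : Fin n → M), ∀ y y', SameCell E y y' → (y ∈ ⋃₀ F ↔ y' ∈ ⋃₀ F) := by
  classical
  choose! E hE using fun I hIF => (hI I hIF).exists_cells
  let G := hF.toFinset.biUnion E
  refine ⟨G.card, fun k => (G.equivFin.symm k : M), fun y y' h => ?_⟩
  have key : ∀ I ∈ F, (y ∈ I ↔ y' ∈ I) := fun I hIF => hE I hIF y y' fun k => by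
    have := h (G.equivFin ⟨k, Finset.mem_biUnion.2 ⟨I, hF.mem_toFinset.2 hIF, k.2⟩⟩)
    simpa using this
  simp only [Set.mem_sUnion]
  exact exists_congr fun I => and_congr_right fun hIF => key I hIF

theorem tame_of_oMinimal {S : OrderedGroupSymbols L} {T : L.Theory} (hqe : HasQE T)
    (hT : HasUniversalAxiomatization T) (hM : M ⊨ T) (ho : OMinimal S M) :
    ∃ _ : LinearOrder M, Tame L M := by
  classical
  have := ho.1
  let i : LinearOrder M := linearOrderOfSTO (S.ltOn M)
  refine ⟨i, ⟨?_, ?_, ?_⟩⟩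
  · refine ⟨S.lt.formula ![Term.var 0, Term.var 1], fun v => ?_⟩
    rw [Formula.realize_rel]
    change _ ↔ Structure.RelMap S.lt ![v 0, v 1]
    refine iff_of_eq (congrArg _ ?_)
    funext k
    fin_cases k <;> rfl
  · intro X hX
    obtain ⟨F, hF, hI, rfl⟩ := ho.2 X hX
    exact exists_cells_sUnion hF hI
  · exact .of_hasQE hqe hT hM fun N => ⟨⟨_, N.fun_mem S.zero ![] fun k => k.elim0⟩⟩

end OMinimal

/-! ### From one parameter variable to several -/

section Dependence

/-- The truth value of `p` is eventually constant. -/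
def EventuallyConstant (p : ℕ → Prop) : Prop :=
  (∀ᶠ i in atTop, p i) ∨ ∀ᶠ i in atTop, ¬ p i

theorem EventuallyConstant.imp {p q : ℕ → Prop} (hp : EventuallyConstant p)
    (hq : EventuallyConstant q) : EventuallyConstant fun i => p i → q i := by
  rcases hp with hp | hp
  · rcases hq with hq | hq
    · exact .inl (hq.mono fun i h _ => h)
    · exact .inr ((hp.and hq).mono fun i h h' => h.2 (h' h.1))
  · exact .inl (hp.mono fun i h h' => (h h').elim)

theorem exists_alternating {p : ℕ → Prop} (hp : ¬ EventuallyConstant p) (N : ℕ) :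
    ∃ h : ℕ → ℕ, StrictMono h ∧ ∀ i, N ≤ h i ∧ (p (h i) ↔ Even i) := by
  rw [EventuallyConstant, not_or, not_eventually, not_eventually] at hp
  simp only [not_not] at hp
  refine extraction_forall_of_frequently (P := fun n k => N ≤ k ∧ (p k ↔ Even n)) fun n => ?_
  by_cases hn : Even n
  · exact (hp.2.and_eventually (eventually_ge_atTop N)).mono fun k hk => ⟨hk.2, iff_of_true hk.1 hn⟩
  · exact (hp.1.and_eventually (eventually_ge_atTop N)).mono fun k hk => ⟨hk.2, iff_of_false hk.1 hn⟩

theorem not_eventuallyConstant_of_alternating {p : ℕ → Prop} (hp : ∀ i, p i ↔ Even i) :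
    ¬ EventuallyConstant p := by
  rintro (h | h)
  · obtain ⟨N, hN⟩ := eventually_atTop.1 h
    exact absurd ((hp _).1 (hN (2 * N + 1) (by lia))) (by simp)
  · obtain ⟨N, hN⟩ := eventually_atTop.1 h
    exact hN (2 * N) (by lia) ((hp _).2 (by simp))

variable {L : FirstOrder.Language.{u, v}} {M : Type w} [L.Structure M]

/-- If formulas `φ(x, y)` in a single variable `y` are dependent, then an indiscernible sequence is,
for a given formula, eventually indiscernible over a given element. -/
theorem eventually_indiscernible_over
    (h1 : ∀ {X : Type} {a : ℕ → X → M}, OrderIndiscernible L a → ∀ {R : (X ⊕ Unit → M) → Prop},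
      IsDef L R → ∀ b : M, EventuallyConstant fun i => R (Sum.elim (a i) fun _ => b))
    {X : Type} {a : ℕ → X → M} (ha : OrderIndiscernible L a) (b : M) {r : ℕ}
    {R : ((Fin r × X) ⊕ Unit → M) → Prop} (hR : IsDef L R) :
    ∃ N : ℕ, ∀ i j : Fin r → ℕ, StrictMono i → StrictMono j → (∀ s, N ≤ i s) → (∀ s, N ≤ j s) →
      (R (Sum.elim (fun s => a (i s.1) s.2) fun _ => b) ↔
        R (Sum.elim (fun s => a (j s.1) s.2) fun _ => b)) := by
  classical
  let R' : (Fin r → ℕ) → Prop := fun i => R (Sum.elim (fun s => a (i s.1) s.2) fun _ => b)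
  by_contra! hcon
  have hcon' : ∀ N, ∃ p : (Fin r → ℕ) × (Fin r → ℕ), StrictMono p.1 ∧ StrictMono p.2 ∧
      (∀ s t, p.1 s < p.2 t) ∧ (∀ s, N ≤ p.1 s) ∧ (∀ s, N ≤ p.2 s) ∧ R' p.1 ∧ ¬ R' p.2 := by
    have hpos : ∀ N, ∃ i : Fin r → ℕ, StrictMono i ∧ (∀ s, N ≤ i s) ∧ R' i := fun N => by
      obtain ⟨i, j, hi, hj, hNi, hNj, h | h⟩ := hcon N
      · exact ⟨i, hi, hNi, h.1⟩
      · exact ⟨j, hj, hNj, h.2⟩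
    have hneg : ∀ N, ∃ i : Fin r → ℕ, StrictMono i ∧ (∀ s, N ≤ i s) ∧ ¬ R' i := fun N => by
      obtain ⟨i, j, hi, hj, hNi, hNj, h | h⟩ := hcon N
      · exact ⟨j, hj, hNj, h.2⟩
      · exact ⟨i, hi, hNi, h.1⟩
    intro N
    obtain ⟨i, hi, hNi, hRi⟩ := hpos N
    obtain ⟨j, hj, hNj, hRj⟩ := hneg (N + Finset.univ.sup i + 1)
    refine ⟨(i, j), hi, hj, fun s t => ?_, hNi, fun s => ?_, hRi, hRj⟩
    · have := Finset.le_sup (f := i) (Finset.mem_univ s)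
      have := hNj t
      lia
    · have := hNj s
      lia
  -- If the conclusion fails, there are increasing `r`-tuples of indices arbitrarily far out with
  -- either truth value. They are stacked in pairs, a true block before a false one, each pair
  -- beyond all earlier ones. The blocks form an indiscernible sequence that alternates against the
  -- single element `b`.
  obtain ⟨f, hf, hf'⟩ := exists_seq_of_forall_finset_exists
    (fun p : (Fin r → ℕ) × (Fin r → ℕ) => StrictMono p.1 ∧ StrictMono p.2 ∧
      (∀ s t, p.1 s < p.2 t) ∧ R' p.1 ∧ ¬ R' p.2) (fun p q => ∀ s t, p.2 s < q.1 t) (by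
      intro S _
      obtain ⟨p, h1, h2, h3, h4, -, h6, h7⟩ :=
        hcon' (S.sup (fun q => Finset.univ.sup q.2) + 1)
      refine ⟨p, ⟨h1, h2, h3, h6, h7⟩, fun q hq s t => ?_⟩
      have e1 := Finset.le_sup (f := q.2) (Finset.mem_univ s)
      have e2 := Finset.le_sup (f := fun q : (Fin r → ℕ) × (Fin r → ℕ) => Finset.univ.sup q.2) hq
      have := h4 t
      lia)
  let J : ℕ → Fin r → ℕ := fun k => if Even k then (f (k / 2)).1 else (f (k / 2)).2
  have hJm : ∀ k, StrictMono (J k) := fun k => by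
    by_cases hk : Even k
    · simpa [J, hk] using (hf (k / 2)).1
    · simpa [J, hk] using (hf (k / 2)).2.1
  have hlow : ∀ k s, (f (k / 2)).1 s ≤ J k s := fun k s => by
    by_cases hk : Even k
    · simp [J, hk]
    · simpa [J, hk] using ((hf (k / 2)).2.2.1 s s).le
  have hhigh : ∀ k s, J k s ≤ (f (k / 2)).2 s := fun k s => by
    by_cases hk : Even k
    · simpa [J, hk] using ((hf (k / 2)).2.2.1 s s).le
    · simp [J, hk]
  have hJlt : ∀ k l, k < l → ∀ s t, J k s < J l t := by
    intro k l hkl s t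
    rcases (Nat.div_le_div_right (c := 2) hkl.le).lt_or_eq with h | h
    · exact (hhigh k s).trans_lt ((hf' _ _ h s t).trans_le (hlow l t))
    · have hk : Even k := by
        by_contra hk
        rw [Nat.not_even_iff] at hk
        lia
      have hl : ¬ Even l := fun hl => by
        rw [Nat.even_iff] at hk hl
        lia
      simp only [J, hk, hl, if_true, if_false, h]
      exact (hf _).2.2.1 s t
  have hJ : ∀ (y z : Fin r) (k l : ℕ), J k y < J l z ↔ k < l ∨ (k = l ∧ y < z) := by
    intro y z k l
    rcases lt_trichotomy k l with h | rfl | h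
    · exact iff_of_true (hJlt k l h y z) (.inl h)
    · simp [(hJm k).lt_iff_lt]
    · exact iff_of_false (hJlt l k h z y).not_gt (by lia)
  have hind := ha.of_terms J (fun y z k l k' l' e1 e2 => by rw [hJ, hJ, e1, e2])
    (fun x : Fin r × X => Term.var x)
  refine not_eventuallyConstant_of_alternating (p := fun k => R' (J k)) (fun k => ?_)
    (h1 hind hR b)
  by_cases hk : Even k
  · simpa [J, hk] using (hf (k / 2)).2.2.2.1
  · simpa [J, hk] using (hf (k / 2)).2.2.2.2

/-- If formulas `φ(x, y)` in a single variable `y` are dependent, then all formulas are. -/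
theorem eventuallyConstant_of_one [Nonempty M] {κ : Cardinal.{w}} (hsat : Saturated L M κ)
    (hκ : ℵ₀ ≤ κ)
    (h1 : ∀ {X : Type} {a : ℕ → X → M}, OrderIndiscernible L a → ∀ {R : (X ⊕ Unit → M) → Prop},
      IsDef L R → ∀ b : M, EventuallyConstant fun i => R (Sum.elim (a i) fun _ => b))
    (q : ℕ) {X : Type} [Countable X] {a : ℕ → X → M} (ha : OrderIndiscernible L a)
    {R : (X ⊕ Fin q → M) → Prop} (hR : IsDef L R) (b : Fin q → M) :
    EventuallyConstant fun i => R (Sum.elim (a i) b) := by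
  induction q generalizing X with
  | zero =>
    have hR' : IsDef L fun v : X → M => R (Sum.elim v b) := by
      refine (hR.comp (Sum.elim id fun k : Fin 0 => k.elim0)).congr fun v => ?_
      refine iff_of_eq (congrArg R ?_)
      funext i; rcases i with i | i
      · rfl
      · exact i.elim0
    by_cases h : R (Sum.elim (a 0) b)
    · exact .inl (.of_forall fun i => (ha.isDef_iff hR' 0 i).1 h)
    · exact .inr (.of_forall fun i h' => h ((ha.isDef_iff hR' 0 i).2 h'))
  | succ q ih =>
    by_contra hcon
    choose g hg hg' using exists_alternating hcon
    -- A limit of the alternating subsequences `a ∘ g N`, together with `b`, as their starting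
    -- points tend to infinity. Alternation survives, and eventual indiscernibility over `b 0`,
    -- formula by formula, becomes indiscernibility over `d 0`. The element `d 0` can then be
    -- appended to each member of the sequence, leaving `q` parameters.
    obtain ⟨e', he'⟩ := exists_realize_of_eventually (V := (ℕ × X) ⊕ Fin (q + 1)) hsat
      (N := M) (fun _ => id) (atTop : Filter ℕ) (by
        refine le_trans ?_ (Cardinal.lift_le.2 hκ)
        rw [Cardinal.lift_aleph0, Cardinal.lift_le_aleph0]
        exact Cardinal.mk_le_aleph0)
      (fun N => Sum.elim (fun p => a (g N p.1) p.2) b)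
    have hreal : ∀ {Q : ((ℕ × X) ⊕ Fin (q + 1) → M) → Prop}, IsDef L Q →
        (∀ᶠ N in atTop, Q (Sum.elim (fun p => a (g N p.1) p.2) b)) → Q e' := by
      rintro Q ⟨φ, hφ⟩ h
      exact (hφ _).1 (he' φ (h.mono fun N hN => (hφ _).2 hN))
    let c : ℕ → X → M := fun i x => e' (Sum.inl (i, x))
    let d : Fin (q + 1) → M := fun k => e' (Sum.inr k)
    have halt : ∀ i, R (Sum.elim (c i) d) ↔ Even i := by
      intro i
      have h2 : IsDef L fun v : (ℕ × X) ⊕ Fin (q + 1) → M =>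
          R (v ∘ Sum.map (fun x => (i, x)) id) := hR.comp _
      have h3 : ∀ (y : ℕ → X → M) (z : Fin (q + 1) → M), Sum.elim (fun p : ℕ × X => y p.1 p.2) z ∘
          Sum.map (fun x => (i, x)) id = Sum.elim (y i) z := fun y z => by
        funext k; rcases k with k | k <;> rfl
      have h4 : e' = Sum.elim (fun p : ℕ × X => c p.1 p.2) d := by
        funext k; rcases k with k | k <;> rfl
      have h5 := hreal (h2.iff (IsDef.const (Even i))) (.of_forall fun N => by
        rw [h3 (fun n => a (g N n)) b]
        exact (hg' N i).2)
      rwa [h4, h3] at h5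
    have hind : OrderIndiscernible L (X := X ⊕ Unit) fun i => Sum.elim (c i) fun _ => d 0 := by
      intro r φ i j hi hj
      let ρ : Fin r × (X ⊕ Unit) → (Fin r × X) ⊕ Unit := fun s =>
        Sum.elim (fun x => Sum.inl (s.1, x)) (fun _ => Sum.inr ()) s.2
      have hQ : IsDef L fun v : (Fin r × X) ⊕ Unit → M => φ.Realize (v ∘ ρ) :=
        (IsDef.of_formula φ).comp ρ
      obtain ⟨N, hN⟩ := eventually_indiscernible_over h1 ha (b 0) hQ
      have hρ : ∀ (y : ℕ → X → M) (z : M) (i : Fin r → ℕ),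
          Sum.elim (fun s : Fin r × X => y (i s.1) s.2) (fun _ => z) ∘ ρ =
            fun s => Sum.elim (y (i s.1)) (fun _ => z) s.2 := by
        intro y z i
        funext ⟨s, k⟩; rcases k with k | k <;> rfl
      have h2 : ∀ i : Fin r → ℕ, IsDef L fun v : (ℕ × X) ⊕ Fin (q + 1) → M =>
          φ.Realize (fun s => Sum.elim (fun x => v (Sum.inl (i s.1, x)))
            (fun _ => v (Sum.inr 0)) s.2) := fun i => by
        refine ((IsDef.of_formula φ).comp fun s : Fin r × (X ⊕ Unit) =>
          (Sum.elim (fun x => Sum.inl (i s.1, x)) (fun _ => Sum.inr 0) s.2 :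
            (ℕ × X) ⊕ Fin (q + 1))).congr fun v => ?_
        refine iff_of_eq (congrArg φ.Realize ?_)
        funext ⟨s, k⟩; rcases k with k | k <;> rfl
      refine hreal ((h2 i).iff (h2 j)) ?_
      filter_upwards [eventually_ge_atTop N] with n hn
      have h3 := hN (g n ∘ i) (g n ∘ j) ((hg n).comp hi) ((hg n).comp hj)
        (fun s => hn.trans (hg' n _).1) (fun s => hn.trans (hg' n _).1)
      rw [hρ a (b 0) (g n ∘ i), hρ a (b 0) (g n ∘ j)] at h3
      exact h3
    have hR' : IsDef L fun v : (X ⊕ Unit) ⊕ Fin q → M => R (Sum.elim (fun x => v (Sum.inl (Sum.inl x)))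
        (Fin.cons (v (Sum.inl (Sum.inr ()))) fun k => v (Sum.inr k))) := by
      refine (hR.comp (Sum.elim (Sum.inl ∘ Sum.inl)
        (Fin.cons (Sum.inl (Sum.inr ())) Sum.inr) : X ⊕ Fin (q + 1) → (X ⊕ Unit) ⊕ Fin q)).congr
        fun v => iff_of_eq (congrArg R ?_)
      funext k; rcases k with k | k
      · rfl
      · refine Fin.cases ?_ (fun k => ?_) k <;> rfl
    refine not_eventuallyConstant_of_alternating halt ?_
    have := ih hind hR' (fun k => d k.succ)
    rw [show d = Fin.cons (d 0) fun k => d k.succ from (Fin.cons_self_tail d).symm]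
    exact this

/-- Formulas in a tame saturated structure are dependent. -/
theorem Tame.eventuallyConstant [LinearOrder M] [Nonempty M] (hM : Tame L M) {κ : Cardinal.{w}}
    (hsat : Saturated L M κ) (hκ : ℵ₀ ≤ κ) {q : ℕ} {X : Type} [Countable X] {a : ℕ → X → M}
    (ha : OrderIndiscernible L a) {R : (X ⊕ Fin q → M) → Prop} (hR : IsDef L R) (b : Fin q → M) :
    EventuallyConstant fun i => R (Sum.elim (a i) b) :=
  eventuallyConstant_of_one hsat hκ (fun ha _ hR b => hM.eventually_const_one ha hR b) q ha hR b

theorem Saturated.of_onLanguage {L' : FirstOrder.Language} [L'.Structure M] (ϕ : L →ᴸ L')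
    [ϕ.IsExpansionOn M] {κ : Cardinal.{w}} (h : Saturated L' M κ) : Saturated L M κ := by
  classical
  intro C hC p hp
  obtain ⟨x, hx⟩ := h C hC (ϕ.onFormula '' p) (by
    intro q hq
    obtain ⟨q', hq', rfl⟩ := Finset.subset_set_image_iff.1 hq
    obtain ⟨x, hx⟩ := hp q' hq'
    refine ⟨x, fun φ hφ => ?_⟩
    obtain ⟨ψ, hψ, rfl⟩ := Finset.mem_image.1 hφ
    rw [LHom.realize_onFormula]
    exact hx ψ hψ)
  refine ⟨x, fun φ hφ => ?_⟩
  have := hx _ (Set.mem_image_of_mem _ hφ)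
  rwa [LHom.realize_onFormula] at this

end Dependence

/-! ### Stretching indiscernible sequences and order patterns -/

section Stretching

variable {L : FirstOrder.Language.{u, v}} {M : Type w} [L.Structure M]

/-- An indiscernible sequence along which the truth value of `θ(x, b)` is not eventually constant
can be replaced by one of any length at most `κ`, with a prescribed alternation. -/
theorem exists_stretch_alternating [Nonempty M] {κ : Cardinal.{w}} (hsat : Saturated L M κ)
    (hκ : ℵ₀ ≤ κ) {X Y : Type} [Countable X] [Countable Y] {a : ℕ → X → M}
    (ha : OrderIndiscernible L a) {R : (X ⊕ Y → M) → Prop} (hR : IsDef L R) {b : Y → M}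
    (hb : ¬ EventuallyConstant fun i => R (Sum.elim (a i) b))
    {I : Type w} [LinearOrder I] (hI : #I ≤ κ) (P : I → Prop) :
    ∃ (c : I → X → M) (d : Y → M), OrderIndiscernible L c ∧ ∀ i, R (Sum.elim (c i) d) ↔ P i := by
  classical
  obtain ⟨g, hg, hg'⟩ := exists_alternating hb 0
  -- The position of `i` in `J` is doubled so that a free parity bit can encode `P i`; along `g`,
  -- even arguments are those where the relation holds.
  let h : Finset I → I → ℕ := fun J i =>
    g (2 * (J.filter (· < i)).card + if P i then 0 else 1)
  have hmono : ∀ (J : Finset I) {i j : I}, i ∈ J → i < j → h J i < h J j := by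
    intro J i j hi hij
    refine hg ?_
    have : (J.filter (· < i)).card < (J.filter (· < j)).card :=
      Finset.card_lt_card (Finset.ssubset_iff_of_subset (fun k hk => by
        simp only [Finset.mem_filter] at hk ⊢
        exact ⟨hk.1, hk.2.trans hij⟩) |>.2 ⟨i, by simp [hi, hij], by simp⟩)
    split_ifs <;> lia
  have hP : ∀ J i, R (Sum.elim (a (h J i)) b) ↔ P i := by
    intro J i
    rw [(hg' _).2]
    by_cases hi : P i <;> simp [hi, parity_simps]
  obtain ⟨e', he'⟩ := exists_realize_of_eventually (V := (I × X) ⊕ Y) hsat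
    (N := M) (fun _ => id) (atTop : Filter (Finset I)) (by
      rw [Cardinal.lift_id, Cardinal.lift_id, Cardinal.mk_sum, Cardinal.mk_prod]
      refine Cardinal.add_le_of_le hκ ?_ ?_
      · simp only [Cardinal.lift_uzero]
        exact Cardinal.mul_le_of_le hκ hI ((Cardinal.lift_le_aleph0.2 Cardinal.mk_le_aleph0).trans hκ)
      · exact (Cardinal.lift_le_aleph0.2 Cardinal.mk_le_aleph0).trans hκ)
    (fun J => Sum.elim (fun p => a (h J p.1) p.2) b)
  have hreal : ∀ {Q : ((I × X) ⊕ Y → M) → Prop}, IsDef L Q →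
      (∀ᶠ J in atTop, Q (Sum.elim (fun p => a (h J p.1) p.2) b)) → Q e' := by
    rintro Q ⟨φ, hφ⟩ h
    exact (hφ _).1 (he' φ (h.mono fun N hN => (hφ _).2 hN))
  refine ⟨fun i x => e' (Sum.inl (i, x)), fun k => e' (Sum.inr k), ?_, fun i => ?_⟩
  · intro r φ i j hi hj
    refine hreal (Q := fun v => φ.Realize (fun s => v (Sum.inl (i s.1, s.2))) ↔
      φ.Realize (fun s => v (Sum.inl (j s.1, s.2)))) ?_ ?_
    · exact IsDef.iff ((IsDef.of_formula φ).comp fun s : Fin r × X => Sum.inl (i s.1, s.2))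
        ((IsDef.of_formula φ).comp fun s : Fin r × X => Sum.inl (j s.1, s.2))
    · filter_upwards [eventually_ge_atTop (Finset.univ.image i ∪ Finset.univ.image j)] with J hJ
      exact ha r φ (h J ∘ i) (h J ∘ j)
        (fun s t hst => hmono J (hJ (by simp)) (hi hst))
        (fun s t hst => hmono J (hJ (by simp)) (hj hst))
  · have h2 : IsDef L fun v : (I × X) ⊕ Y → M => R (v ∘ Sum.map (fun x => (i, x)) id) := hR.comp _
    have h3 : ∀ (y : I → X → M) (z : Y → M), Sum.elim (fun p : I × X => y p.1 p.2) z ∘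
        Sum.map (fun x => (i, x)) id = Sum.elim (y i) z := fun y z => by
      funext k; rcases k with k | k <;> rfl
    have h4 : e' = Sum.elim (fun p : I × X => e' (Sum.inl (p.1, p.2))) fun k => e' (Sum.inr k) := by
      funext k; rcases k with k | k <;> rfl
    have h5 := hreal (h2.iff (IsDef.const (P i))) (.of_forall fun J => by
      rw [h3 (fun i => a (h J i)) b]
      exact hP J i)
    rwa [h4, h3 fun i x => e' (Sum.inl (i, x))] at h5

/-- A sequence of tuples of indices has a subsequence that, doubled suitably, follows a fixed order
pattern. -/
theorem exists_pattern {I Y : Type*} [LinearOrder I] [Finite Y] (J : ℕ → Y → I) (y₀ : Y)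
    (hinj : Function.Injective fun k => J k y₀) :
    ∃ (g : ℕ → ℕ) (J' : ℕ → Y → I ×ₗ Bool),
      (∀ (y z : Y) (k l k' l' : ℕ), (k < l ↔ k' < l') → (k = l ↔ k' = l') →
        (J' k y < J' l z ↔ J' k' y < J' l' z)) ∧
      (∀ k y, Even k → J' k y = toLex (J (g k) y, false)) ∧
      (∀ k, ¬ Even k → J' k y₀ = toLex (J (g k) y₀, true)) := by
  classical
  obtain ⟨g, K, hg, hK⟩ := exists_strictMono_homogeneous
    (fun k l => fun p : Y × Y => (decide (J k p.1 < J l p.2), decide (J l p.2 < J k p.1),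
      decide (J k p.1 < J k p.2)))
  let H : ℕ → Y → I := fun k => J (g k)
  have h1 : ∀ {k l : ℕ} (y z : Y), k < l → (H k y < H l z ↔ (K (y, z)).1 = true) :=
    fun {k l} y z hkl => by rw [← hK k l hkl]; simp [H]
  have h2 : ∀ {k l : ℕ} (y z : Y), k < l → (H l z < H k y ↔ (K (y, z)).2.1 = true) :=
    fun {k l} y z hkl => by rw [← hK k l hkl]; simp [H]
  have h3 : ∀ (k : ℕ) (y z : Y), (H k y < H k z ↔ (K (y, z)).2.2 = true) :=
    fun k y z => by rw [← hK k (k + 1) (by lia)]; simp [H]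
  have heq : ∀ {k l k' l' : ℕ} (y z : Y), k < l → k' < l' → H k y = H l z → H k' y = H l' z := by
    intro k l k' l' y z hkl hkl' h
    rw [le_antisymm_iff, ← not_lt, ← not_lt] at h ⊢
    rwa [h1 y z hkl', h2 y z hkl', ← h1 y z hkl, ← h2 y z hkl]
  have heq' : ∀ {k k' : ℕ} (y z : Y), H k y = H k z → H k' y = H k' z := by
    intro k k' y z h
    rw [le_antisymm_iff, ← not_lt, ← not_lt] at h ⊢
    rwa [h3, h3, ← h3 k, ← h3 k]
  -- The coordinates whose index is constant along the Ramsey subsequence. Any coincidence of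
  -- indices at two different times involves only such coordinates.
  let root : Y → Prop := fun y => H 0 y = H 1 y
  have hroot : ∀ {k l : ℕ} (y z : Y), k < l → H k y = H l z → root y ∧ root z := by
    intro k l y z hkl h
    have e := fun {k' l' : ℕ} (h' : k' < l') => heq y z hkl h' h
    exact ⟨(e (show 0 < 2 by lia)).trans (e (show 1 < 2 by lia)).symm,
      heq z z (show 1 < 2 by lia) zero_lt_one
        ((e (show 0 < 1 by lia)).symm.trans (e (show 0 < 2 by lia)))⟩
  have hroot' : ∀ {k : ℕ} (y z : Y), H k y = H k z → (root y ↔ root z) := by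
    intro k y z h
    simp only [root, heq' y z h]
  -- At odd times every non-constant index moves to its second copy, while constant ones stay. Equal
  -- indices always receive the same Boolean, so the order pattern is that of `H`.
  let J' : ℕ → Y → I ×ₗ Bool := fun k y => toLex (H k y, decide (¬ Even k ∧ ¬ root y))
  have hlt : ∀ k l y z, J' k y < J' l z ↔ H k y < H l z := by
    intro k l y z
    rw [Prod.Lex.toLex_lt_toLex]
    refine or_iff_left ?_
    rintro ⟨e1, e2⟩
    dsimp only at e1 e2
    rcases lt_trichotomy k l with hkl | rfl | hkl
    · obtain ⟨r1, r2⟩ := hroot y z hkl e1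
      simp [r1, r2] at e2
    · simp [hroot' y z e1] at e2
    · obtain ⟨r1, r2⟩ := hroot z y hkl e1.symm
      simp [r1, r2] at e2
  refine ⟨g, J', ?_, ?_, ?_⟩
  · intro y z k l k' l' e1 e2
    rw [hlt, hlt]
    rcases lt_trichotomy k l with hkl | hkl | hkl
    · rw [h1 y z hkl, h1 y z (e1.1 hkl)]
    · obtain rfl := hkl
      obtain rfl := e2.1 rfl
      rw [h3, h3]
    · have : l' < k' := by lia
      rw [h2 z y hkl, h2 z y this]
  · intro k y hk
    simp [J', hk, H]
  · intro k hk
    have : ¬ root y₀ := fun h => absurd (hg.injective (hinj h)) zero_ne_one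
    have hk' : Odd k := Nat.not_even_iff_odd.1 hk
    simp [J', hk', H, this]

end Stretching

/-! ### Counting shapes of term expressions -/

section Shapes

variable {L : FirstOrder.Language.{u, v}} {M : Type w} [L.Structure M]

theorem exists_term_finite_left {A C : Type*} (T : L.Term (A ⊕ C)) :
    ∃ (r : ℕ) (y : Fin r → A) (G : L.Term (Fin r ⊕ C)), ∀ (x : A → M) (z : C → M),
      T.realize (Sum.elim x z) = G.realize (Sum.elim (x ∘ y) z) := by
  classical
  let W := T.varFinset.toLeft
  refine ⟨W.card, fun k => W.equivFin.symm k, T.restrictVar fun p => match p with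
    | ⟨Sum.inl i, hi⟩ => Sum.inl (W.equivFin ⟨i, Finset.mem_toLeft.2 hi⟩)
    | ⟨Sum.inr i, _⟩ => Sum.inr i, fun x z => ?_⟩
  refine (Term.realize_restrictVar (Sum.elim x z) ?_).symm
  rintro ⟨i | i, hi⟩ <;> simp

theorem exists_term_finite_family {A X : Type*} {r : ℕ} (T : Fin r → L.Term (A × X)) :
    ∃ (R : ℕ) (y : Fin R → A) (G : Fin r → L.Term (Fin R × X)), ∀ (x : A × X → M) (k : Fin r),
      (T k).realize x = (G k).realize fun p => x (y p.1, p.2) := by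
  classical
  let W : Finset A := Finset.univ.biUnion fun k => (T k).varFinset.image Prod.fst
  refine ⟨W.card, fun k => W.equivFin.symm k, fun k => (T k).restrictVar fun p =>
    (W.equivFin ⟨p.1.1, Finset.mem_biUnion.2 ⟨k, Finset.mem_univ _,
      Finset.mem_image_of_mem _ p.2⟩⟩, p.1.2), fun x k => ?_⟩
  refine (Term.realize_restrictVar x ?_).symm
  intro p
  simp

theorem exists_infinite_fiber_of_lift_lt {α : Type u} {β : Type w} [Infinite β] (f : β → α)
    (h : Cardinal.lift.{w} #α < Cardinal.lift.{u} #β) : ∃ a, (f ⁻¹' {a}).Infinite := by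
  obtain ⟨a, ha⟩ := Cardinal.exists_infinite_fiber
    (fun x : ULift.{u} β => (ULift.up (f x.down) : ULift.{w} α)) (by simpa using h)
  refine ⟨a.down, ?_⟩
  have := (Set.infinite_coe_iff.1 ha).image (f := ULift.down) ULift.down_injective.injOn
  refine this.mono ?_
  rintro _ ⟨x, hx, rfl⟩
  exact congrArg ULift.down hx

theorem card_term_le {A : Type} [Countable A] :
    #(L.Term A) ≤ max ℵ₀ #(Σ i, L.Functions i) := by
  refine Term.card_le.trans (max_le (le_max_left _ _) ?_)
  rw [Cardinal.mk_sum]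
  refine Cardinal.add_le_of_le (le_max_left _ _) ?_ ?_
  · exact (Cardinal.lift_le_aleph0.2 Cardinal.mk_le_aleph0).trans (le_max_left _ _)
  · simp

theorem card_functions_le {L : FirstOrder.Language.{u, v}} :
    Cardinal.lift.{max v w} #(Σ i, L.Functions i) ≤ Cardinal.lift.{w} L.card := by
  rw [Language.card_eq_card_functions_add_card_relations, Cardinal.mk_sigma, ← Cardinal.lift_sum,
    Cardinal.lift_add, Cardinal.lift_lift]
  exact le_self_add

/-- The data that describe how an element is obtained from members of an indexed family by terms,
except for the indices. -/
abbrev TermShape (L : FirstOrder.Language.{u, v}) (n : ℕ) (X : Type) : Type u :=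
  Σ p : ℕ × ℕ, L.Term (Fin p.1 ⊕ Fin n) × (Fin p.1 → (addUnary L).Term (Fin p.2 × X))

theorem card_termShape_le (L : FirstOrder.Language.{u, v}) (n : ℕ) (X : Type) [Countable X] :
    #(TermShape L n X) ≤ max ℵ₀ #(Σ i, (addUnary L).Functions i) := by
  set ν : Cardinal.{u} := max ℵ₀ #(Σ i, (addUnary L).Functions i) with hν
  have hν0 : ℵ₀ ≤ ν := le_max_left _ _
  have hL : #(Σ i, L.Functions i) ≤ #(Σ i, (addUnary L).Functions i) :=
    Cardinal.mk_le_of_injective (f := Sigma.map id fun _ => Sum.inl)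
      (Function.injective_id.sigma_map fun _ => Sum.inl_injective)
  have h1 : ∀ p : ℕ × ℕ, #(L.Term (Fin p.1 ⊕ Fin n) ×
      (Fin p.1 → (addUnary L).Term (Fin p.2 × X))) ≤ ν := by
    intro p
    rw [Cardinal.mk_prod, Cardinal.lift_id, Cardinal.lift_id]
    refine Cardinal.mul_le_of_le hν0 (card_term_le.trans (max_le_max_left _ hL)) ?_
    have : #(Fin p.1 → (addUnary L).Term (Fin p.2 × X)) =
        #((addUnary L).Term (Fin p.2 × X)) ^ p.1 := by simp
    rw [this]
    exact (pow_le_pow_left' card_term_le _).trans (Cardinal.power_nat_le hν0)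
  rw [Cardinal.mk_sigma]
  refine (Cardinal.sum_le_sum _ (fun _ => ν) h1).trans ?_
  rw [Cardinal.sum_const]
  refine Cardinal.mul_le_of_le hν0 ?_ (by simp)
  exact (Cardinal.lift_le_aleph0.2 Cardinal.mk_le_aleph0).trans hν0

/-- A shape is a finite sequence of terms over countably many variables, and `κ` exceeds both `ℵ₀`
and the size of the language. -/
theorem lift_card_termShape_lt {κ : Cardinal.{w}} (hκ : ℵ₀ < κ) {L : FirstOrder.Language.{u, v}}
    (hL : Cardinal.lift.{w} (addUnary L).card < Cardinal.lift.{max u v} κ) (n : ℕ) (X : Type)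
    [Countable X] : Cardinal.lift.{w} #(TermShape L n X) < Cardinal.lift.{u} κ := by
  rw [← Cardinal.lift_lt.{_, v}, Cardinal.lift_lift, Cardinal.lift_lift]
  refine (Cardinal.lift_le.2 (card_termShape_le L n X)).trans_lt ?_
  rw [Cardinal.lift_max, Cardinal.lift_aleph0]
  refine max_lt (by simpa using hκ) (lt_of_le_of_lt ?_ hL)
  exact card_functions_le (L := addUnary L)

end Shapes

/-! ### Eliminating one application of `f` -/

section Unary

variable {L : FirstOrder.Language.{u, v}} {M : Type w} [L.Structure M] [unaryLanguage.Structure M]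

/-- The term `f(t)` of `L(f)`. -/
def fTerm {α : Type*} (t : (addUnary L).Term α) : (addUnary L).Term α :=
  Term.func (L := addUnary L) (l := 1) (Sum.inr UnaryFunc.f) ![t]

@[simp]
theorem realize_fTerm {α : Type*} (t : (addUnary L).Term α) (x : α → M) :
    (fTerm t).realize x = theMap M (t.realize x) := by
  change Structure.funMap (L := unaryLanguage) UnaryFunc.f _ = _
  rw [theMap]
  congr 1
  funext k
  fin_cases k
  rfl

/-- The `L`-term `t` as a term of `L(f)`. -/
abbrev liftTerm {α : Type*} (t : L.Term α) : (addUnary L).Term α :=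
  (LHom.sumInl : L →ᴸ addUnary L).onTerm t

theorem realize_liftTerm {α : Type*} (t : L.Term α) (x : α → M) :
    (liftTerm t).realize x = t.realize x :=
  LHom.realize_onTerm _ _ _

variable (L M) in
/-- The closure condition on `f`, with the new generators in the image of `f`. -/
def MapClosureCondition : Prop :=
  ∀ B : L.Substructure M, (∀ b ∈ B, theMap M b ∈ B) → ∀ {Y : Type} [Finite Y] (c : Y → M),
    ∃ (n : ℕ) (d : Fin n → M), (∀ k, d k ∈ Set.range (theMap M)) ∧
      theMap M '' (Substructure.closure L ((B : Set M) ∪ Set.range c) : Set M) ⊆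
        (Substructure.closure L (theMap M '' (B : Set M) ∪ Set.range d) : Set M)

variable (L M) in
/-- The equations `f(t(x, y)) = g(x', z)` are dependent when `x'`, `z` range over the image
of `f`. -/
def MapEquationCondition : Prop :=
  ∀ {X Y : Type} [Finite X] [Finite Y] {r n : ℕ} (t : L.Term (X ⊕ Y))
    (g : L.Term (Fin r ⊕ Fin n)) (a : ℕ → Fin r ⊕ X → M), OrderIndiscernible (addUnary L) a →
    (∀ i j, a i (Sum.inl j) ∈ Set.range (theMap M)) → ∀ (b : Y → M) (e : Fin n → M),
    (∀ j, e j ∈ Set.range (theMap M)) →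
    EventuallyConstant fun i => theMap M (t.realize (Sum.elim (a i ∘ Sum.inr) b)) =
      g.realize (Sum.elim (a i ∘ Sum.inl) e)

variable (L) in
/-- The relation `S` is definable in `L(f)`, and all relations obtained from it by substitution
of `L`-terms are dependent. -/
def DependentUnderTerms {α : Type} (S : (α → M) → Prop) : Prop :=
  IsDef (addUnary L) S ∧ ∀ {X Y : Type} [Finite X] [Finite Y] (τ : α → L.Term (X ⊕ Y))
    (a : ℕ → X → M), OrderIndiscernible (addUnary L) a → ∀ b : Y → M,
    EventuallyConstant fun i => S fun x => (τ x).realize (Sum.elim (a i) b)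

theorem DependentUnderTerms.subst {α β : Type} {S : (α → M) → Prop} (hS : DependentUnderTerms L S)
    (ρ : α → L.Term β) : DependentUnderTerms L fun v : β → M => S fun x => (ρ x).realize v := by
  refine ⟨?_, fun τ a ha b => ?_⟩
  · refine (hS.1.subst fun x => liftTerm (ρ x)).congr fun v => ?_
    simp only [realize_liftTerm]
  · have := hS.2 (fun x => (ρ x).subst τ) a ha b
    simpa only [Term.realize_subst] using this

/-- Elements of `f(B)` have the form `f(σ(c))` for `L(f)`-terms `σ`; an `L`-term uses finitely many
of these, and each `σ` uses finitely many indices. What remains after forgetting the indices `J` is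
the shape. -/
theorem exists_termShape {Λ X : Type*} {B : L.Substructure M} {c : Λ × X → M}
    (hB : (B : Set M) = Substructure.closure (addUnary L) (Set.range c)) {n : ℕ} {e : Fin n → M}
    {z : M} (hz : z ∈ Substructure.closure L (theMap M '' (B : Set M) ∪ Set.range e)) :
    ∃ (p : ℕ × ℕ) (G : L.Term (Fin p.1 ⊕ Fin n)) (s : Fin p.1 → (addUnary L).Term (Fin p.2 × X))
      (J : Fin p.2 → Λ), z = G.realize (Sum.elim
        (fun l => theMap M ((s l).realize fun q => c (J q.1, q.2))) e) := by
  have h1 : theMap M '' (B : Set M) ∪ Set.range e = Set.range (Sum.elim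
      (fun σ : (addUnary L).Term (Λ × X) => theMap M (σ.realize c)) e) := by
    rw [Set.Sum.elim_range, hB]
    congr 1
    ext x
    simp only [Set.mem_image, SetLike.mem_coe, mem_closure_range_iff, Set.mem_range]
    constructor
    · rintro ⟨_, ⟨t, rfl⟩, rfl⟩
      exact ⟨t, rfl⟩
    · rintro ⟨t, rfl⟩
      exact ⟨_, ⟨t, rfl⟩, rfl⟩
  rw [h1, mem_closure_range_iff] at hz
  obtain ⟨T, rfl⟩ := hz
  obtain ⟨r, y, G, hG⟩ := exists_term_finite_left (M := M) T
  obtain ⟨R, J, s, hs⟩ := exists_term_finite_family (M := M) y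
  refine ⟨(r, R), G, s, J, ?_⟩
  rw [hG]
  congr 2
  funext l
  simp only [Function.comp_apply, hs]

/-- Dependence is preserved when a variable is replaced by `f` of another variable. -/
theorem DependentUnderTerms.theMap [Nonempty M] {κ : Cardinal.{w}}
    (hsat : Saturated (addUnary L) M κ) (hκ : ℵ₀ < κ)
    (hL : Cardinal.lift.{w} (addUnary L).card < Cardinal.lift.{max u v} κ)
    (hclos : MapClosureCondition L M) (heqn : MapEquationCondition L M)
    {α : Type} {S : (α ⊕ Unit → M) → Prop} (hS : DependentUnderTerms L S) (w : α) :
    DependentUnderTerms L fun v : α → M => S (Sum.elim v fun _ => theMap M (v w)) := by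
  classical
  have hdef : IsDef (addUnary L) fun v : α → M => S (Sum.elim v fun _ => PairNIP.theMap M (v w)) := by
    refine (hS.1.subst (Sum.elim Term.var fun _ => fTerm (Term.var w))).congr fun v => ?_
    refine iff_of_eq (congrArg S ?_)
    funext x; rcases x with x | x
    · rfl
    · exact realize_fTerm _ _
  refine ⟨hdef, ?_⟩
  intro X Y _ _ τ a ha b
  by_contra hcon
  let θ : (X ⊕ Y → M) → Prop := fun v => S (Sum.elim (fun x => (τ x).realize v)
    fun _ => PairNIP.theMap M ((τ w).realize v))
  have hθ : IsDef (addUnary L) θ := by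
    refine (hdef.subst fun x => liftTerm (τ x)).congr fun v => ?_
    simp only [realize_liftTerm, θ]
  let Λ : Type w := κ.ord.ToType
  have hΛ : #Λ = κ := Cardinal.mk_ord_toType κ
  have hΛinf : Infinite Λ := Cardinal.infinite_iff.2 (hΛ ▸ hκ.le)
  obtain ⟨c, d, hc, hcd⟩ := exists_stretch_alternating hsat hκ.le ha hθ hcon (I := Λ ×ₗ Bool) (by
    change #(Λ × Bool) ≤ κ
    rw [Cardinal.mk_prod]
    refine Cardinal.mul_le_of_le hκ.le (by simp [hΛ]) ?_
    exact (Cardinal.lift_le_aleph0.2 Cardinal.mk_le_aleph0).trans hκ.le)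
    (fun i => (ofLex i).2 = false)
  -- Only the members where the relation holds generate `B`; the copies at `true` are kept in
  -- reserve.
  let c₀ : Λ × X → M := fun p => c (toLex (p.1, false)) p.2
  let B' := Substructure.closure (addUnary L) (Set.range c₀)
  let B : L.Substructure M := (LHom.sumInl : L →ᴸ addUnary L).substructureReduct B'
  have hBf : ∀ x ∈ B, PairNIP.theMap M x ∈ B := fun x hx =>
    B'.fun_mem (n := 1) (Sum.inr UnaryFunc.f) ![x] (fun k => by fin_cases k; exact hx)
  obtain ⟨n, e, he, hsub⟩ := hclos B hBf d
  let E : TermShape L n X → Λ → Prop := fun sh l => ∃ J : Fin sh.1.2 → Λ,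
    PairNIP.theMap M ((τ w).realize (Sum.elim (c (toLex (l, false))) d)) =
      sh.2.1.realize (Sum.elim
        (fun k => PairNIP.theMap M ((sh.2.2 k).realize fun q => c₀ (J q.1, q.2))) e)
  have hE : ∀ l, ∃ sh, E sh l := by
    intro l
    obtain ⟨p, G, s, J, h⟩ := exists_termShape (X := X) (c := c₀) (B := B) rfl
      (hsub ⟨_, Term.realize_mem (L := L) (τ w) (Sum.elim (c (toLex (l, false))) d) (by
        rintro (x | y)
        · exact Substructure.subset_closure (.inl (Substructure.subset_closure ⟨(l, x), rfl⟩))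
        · exact Substructure.subset_closure (.inr ⟨y, rfl⟩)), rfl⟩)
    exact ⟨⟨p, G, s⟩, J, h⟩
  choose sh hsh using hE
  -- An infinite fibre suffices for the Ramsey argument, so no regularity of `κ` is needed.
  obtain ⟨⟨⟨r, R⟩, G, s⟩, hinf⟩ := exists_infinite_fiber_of_lift_lt sh (by
    rw [hΛ]
    exact lift_card_termShape_lt hκ hL n X)
  let lam : ℕ → Λ := fun k => (hinf.natEmbedding _ k : Λ)
  have hlam : Function.Injective lam := fun k l h =>
    (hinf.natEmbedding _).injective (Subtype.ext h)
  have hJ : ∀ k, E ⟨(r, R), G, s⟩ (lam k) := fun k => by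
    have h1 : sh (lam k) = ⟨(r, R), G, s⟩ := (hinf.natEmbedding _ k).2
    rw [← h1]
    exact hsh _
  choose J hJ using hJ
  dsimp only at J hJ
  -- The coordinate `none` carries the index of the member itself, and `some` the indices occurring
  -- in its term expression.
  obtain ⟨g, J', hpat, heven, hodd⟩ := exists_pattern
    (fun k (y : Option (Fin R)) => y.elim (lam k) (J k)) none hlam
  let tt : Fin r ⊕ X → (addUnary L).Term (Option (Fin R) × X) := Sum.elim
    (fun k => fTerm ((s k).relabel (Prod.map some id))) fun x => Term.var (none, x)
  let a' : ℕ → Fin r ⊕ X → M := fun k x => (tt x).realize fun p => c (J' k p.1) p.2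
  have ha' : OrderIndiscernible (addUnary L) a' := hc.of_terms J' hpat tt
  have ha'r : ∀ k, a' k ∘ Sum.inr = c (J' k none) := fun k => rfl
  have ha'l : ∀ k, a' k ∘ Sum.inl = fun l =>
      PairNIP.theMap M ((s l).realize fun q => c (J' k (some q.1)) q.2) := fun k => by
    funext l
    simp only [a', tt, Function.comp_apply, Sum.elim_inl, realize_fTerm, Term.realize_relabel]
    rfl
  have heq : EventuallyConstant fun k =>
      PairNIP.theMap M ((τ w).realize (Sum.elim (a' k ∘ Sum.inr) d)) =
        G.realize (Sum.elim (a' k ∘ Sum.inl) e) :=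
    heqn (τ w) G a' ha' (fun k l => ⟨_, (congrFun (ha'l k) l).symm⟩) d e he
  -- The equation holds at every even `k` by the choice of the shape, so eventual constancy extends
  -- it to almost all odd `k`, where the members come from the copies at `true`.
  replace heq : ∀ᶠ k in atTop,
      PairNIP.theMap M ((τ w).realize (Sum.elim (a' k ∘ Sum.inr) d)) =
        G.realize (Sum.elim (a' k ∘ Sum.inl) e) := by
    refine heq.resolve_right fun h => ?_
    obtain ⟨N, hN⟩ := eventually_atTop.1 h
    refine hN (2 * N) (by lia) ?_
    have hev : Even (2 * N) := by simp
    beta_reduce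
    rw [ha'r, ha'l]
    simp only [heven _ _ hev]
    exact hJ (g (2 * N))
  -- With the `f`-value replaced by `G`, only `L`-terms in the enlarged members and parameters are
  -- substituted into `S`, so the dependence of `S` applies.
  have hfin := hS.2 (X := Fin r ⊕ X) (Y := Y ⊕ Fin n)
    (Sum.elim (fun x => (τ x).relabel (Sum.map Sum.inr Sum.inl))
      fun _ => G.relabel (Sum.map Sum.inl Sum.inr)) a' ha' (Sum.elim d e)
  have hiff : ∀ᶠ k in atTop, ((S fun x => ((Sum.elim
      (fun x => (τ x).relabel (Sum.map Sum.inr Sum.inl))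
      (fun _ => G.relabel (Sum.map Sum.inl Sum.inr)) : α ⊕ Unit → L.Term _) x).realize
        (Sum.elim (a' k) (Sum.elim d e))) ↔ Even k) := by
    filter_upwards [heq] with k hk
    have h1 : (fun x => ((Sum.elim
      (fun x => (τ x).relabel (Sum.map Sum.inr Sum.inl))
      (fun _ => G.relabel (Sum.map Sum.inl Sum.inr)) : α ⊕ Unit → L.Term _) x).realize
        (Sum.elim (a' k) (Sum.elim d e))) = Sum.elim
        (fun x => (τ x).realize (Sum.elim (c (J' k none)) d))
        fun _ => PairNIP.theMap M ((τ w).realize (Sum.elim (c (J' k none)) d)) := by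
      funext x; rcases x with x | x
      · simp only [Sum.elim_inl, Term.realize_relabel]
        congr 1
        funext y; rcases y with y | y <;> rfl
      · simp only [Sum.elim_inr, Term.realize_relabel]
        rw [ha'r] at hk
        rw [hk]
        congr 1
        funext y; rcases y with y | y <;> rfl
    rw [h1]
    refine (hcd _).trans ?_
    by_cases hk' : Even k
    · simp [heven k none hk', hk']
    · simp only [hodd k hk', ofLex_toLex, Bool.true_eq_false, false_iff]
      exact hk'
  refine not_eventuallyConstant_of_alternating (p := fun k => Even k) (fun _ => Iff.rfl) ?_
  rcases hfin with h | h
  · exact .inl ((h.and hiff).mono fun k hk => hk.2.1 hk.1)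
  · exact .inr ((h.and hiff).mono fun k hk h' => hk.1 (hk.2.2 h'))

end Unary

/-! ### Quantifier-free formulas and the two conditions on `f` -/

section QuantifierFree

variable {L : FirstOrder.Language.{u, v}} {M : Type w} [L.Structure M] [unaryLanguage.Structure M]

theorem DependentUnderTerms.imp {α : Type} {S S' : (α → M) → Prop} (hS : DependentUnderTerms L S)
    (hS' : DependentUnderTerms L S') : DependentUnderTerms L fun v => S v → S' v :=
  ⟨hS.1.imp hS'.1, fun τ a ha b => (hS.2 τ a ha b).imp (hS'.2 τ a ha b)⟩

theorem DependentUnderTerms.const {α : Type} (p : Prop) :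
    DependentUnderTerms L fun _ : α → M => p := by
  refine ⟨IsDef.const p, fun τ a ha b => ?_⟩
  by_cases hp : p
  · exact .inl (.of_forall fun _ => hp)
  · exact .inr (.of_forall fun _ => hp)

theorem DependentUnderTerms.of_isDef [LinearOrder M] [Nonempty M] (hM : Tame L M)
    {κ : Cardinal.{w}} (hsat : Saturated L M κ) (hκ : ℵ₀ ≤ κ) {α : Type} {S : (α → M) → Prop}
    (hS : IsDef L S) : DependentUnderTerms L S := by
  refine ⟨hS.onFormula LHom.sumInl, ?_⟩
  intro X Y _ _ τ a ha b
  obtain ⟨q, ⟨E⟩⟩ := Finite.exists_equiv_fin Y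
  have h1 := hM.eventuallyConstant hsat hκ (ha.of_onLanguage (LHom.sumInl : L →ᴸ addUnary L))
    ((hS.subst τ).comp (Sum.map id E)) (b ∘ E.symm)
  have h2 : ∀ i, Sum.elim (a i) (b ∘ E.symm) ∘ Sum.map id E = Sum.elim (a i) b := fun i => by
    funext y; rcases y with y | y
    · rfl
    · simp
  simpa only [h2] using h1

/-- The terms are substituted one at a time; the variables not yet treated are carried along as
ordinary free variables. -/
theorem DependentUnderTerms.terms_tuple {β : Type} {n : ℕ} (t : Fin n → (addUnary L).Term β)
    (ht : ∀ k, ∀ {α : Type} {S : (α ⊕ Unit → M) → Prop}, DependentUnderTerms L S →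
      ∀ ρ : β → L.Term α, DependentUnderTerms L fun v : α → M =>
        S (Sum.elim v fun _ => (t k).realize fun x => (ρ x).realize v))
    {α : Type} {S : (α ⊕ Fin n → M) → Prop} (hS : DependentUnderTerms L S) (ρ : β → L.Term α) :
    DependentUnderTerms L fun v : α → M =>
      S (Sum.elim v fun k => (t k).realize fun x => (ρ x).realize v) := by
  induction n generalizing α with
  | zero =>
    convert! hS.subst (Sum.elim Term.var fun k : Fin 0 => k.elim0) using 3 with v
    funext x; rcases x with x | x
    · rfl
    · exact x.elim0
  | succ n ih =>
    have h1 := hS.subst (β := (α ⊕ Fin n) ⊕ Unit) (Sum.elim (fun x => Term.var (Sum.inl (Sum.inl x)))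
      (Fin.cons (Term.var (Sum.inr ())) fun k => Term.var (Sum.inl (Sum.inr k))))
    have h2 := ih (fun k => t k.succ) (fun k => ht k.succ)
      (ht 0 h1 fun x => (ρ x).relabel Sum.inl) ρ
    convert! h2 using 3 with v
    funext x; rcases x with x | x
    · rfl
    · refine Fin.cases ?_ (fun k => ?_) x
      · simp only [Sum.elim_inr, Fin.cons_zero, Term.realize_var, Term.realize_relabel]
        rfl
      · simp

/-- Dependence is preserved when a variable is replaced by a term of `L(f)`, if this is true for
the terms `f(x)`. -/
theorem DependentUnderTerms.term
    (hstep : ∀ {α : Type} {S : (α ⊕ Unit → M) → Prop}, DependentUnderTerms L S → ∀ w : α,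
      DependentUnderTerms L fun v : α → M => S (Sum.elim v fun _ => PairNIP.theMap M (v w)))
    {β : Type} (t : (addUnary L).Term β) {α : Type} {S : (α ⊕ Unit → M) → Prop}
    (hS : DependentUnderTerms L S) (ρ : β → L.Term α) :
    DependentUnderTerms L fun v : α → M =>
      S (Sum.elim v fun _ => t.realize fun x => (ρ x).realize v) := by
  induction t generalizing α with
  | var x =>
    convert! hS.subst (Sum.elim Term.var fun _ => ρ x) using 3 with v
    funext y; rcases y with y | y <;> rfl
  | @func l F ts ih =>
    rcases F with F | F
    · have h1 := hS.subst (β := α ⊕ Fin l) (Sum.elim (fun x => Term.var (Sum.inl x))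
        fun _ => Term.func F fun k => Term.var (Sum.inr k))
      convert! DependentUnderTerms.terms_tuple ts (fun k _ _ hS ρ => ih k hS ρ) h1 ρ using 3 with v
      funext y; rcases y with y | y <;> rfl
    · cases F
      have h1 := hS.subst (β := (α ⊕ Unit) ⊕ Unit) (Sum.elim (fun x => Term.var (Sum.inl (Sum.inl x)))
        fun _ => Term.var (Sum.inr ()))
      convert! ih 0 (hstep h1 (Sum.inr ())) ρ using 3 with v
      funext y; rcases y with y | y
      · rfl
      · change Structure.funMap (L := unaryLanguage) UnaryFunc.f _ = PairNIP.theMap M _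
        rw [PairNIP.theMap]
        congr 1
        funext k
        fin_cases k
        rfl

theorem DependentUnderTerms.of_isQF [LinearOrder M] [Nonempty M] (hM : Tame L M)
    {κ : Cardinal.{w}} (hsat : Saturated L M κ) (hκ : ℵ₀ ≤ κ)
    (hstep : ∀ {α : Type} {S : (α ⊕ Unit → M) → Prop}, DependentUnderTerms L S → ∀ w : α,
      DependentUnderTerms L fun v : α → M => S (Sum.elim v fun _ => PairNIP.theMap M (v w)))
    {α : Type} {φ : (addUnary L).Formula α} (hφ : BoundedFormula.IsQF φ) :
    DependentUnderTerms L (M := M) fun v => φ.Realize v := by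
  have key : ∀ {n : ℕ} (ts : Fin n → (addUnary L).Term (α ⊕ Fin 0)) {R : (Fin n → M) → Prop},
      IsDef L R → DependentUnderTerms L fun v : α → M =>
        R fun k => (ts k).realize (Sum.elim v default) := by
    intro n ts R hR
    have h1 := DependentUnderTerms.terms_tuple ts
      (fun k _ _ hS ρ => DependentUnderTerms.term hstep (ts k) hS ρ)
      (S := fun v : α ⊕ Fin n → M => R (v ∘ Sum.inr)) (.of_isDef hM hsat hκ (hR.comp Sum.inr))
      (Sum.elim Term.var fun k => k.elim0)
    convert! h1 using 3 with v
    funext k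
    simp only [Function.comp_apply, Sum.elim_inr]
    congr 1
    funext x; rcases x with x | x
    · rfl
    · exact x.elim0
  unfold Formula.Realize
  induction hφ with
  | falsum => exact .const False
  | of_isAtomic h =>
    rcases h with ⟨t₁, t₂⟩ | ⟨R, ts⟩
    · convert! key ![t₁, t₂] (IsDef.eq (0 : Fin 2) 1) using 2
    · rcases R with R | R
      · convert! key ts (R := fun x => Structure.RelMap R x) ⟨R.formula Term.var, fun v => by
          rw [Formula.realize_rel]; rfl⟩ using 2
      · exact R.elim
  | imp _ _ ih₁ ih₂ => exact ih₁.imp ih₂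

/-- The given generators need not lie in the image of `f`. They show that `f(B⟨c⟩)` has finite rank
over `f(B)`, so exchange yields a finite generating set inside `f(B⟨c⟩)`, which is what the equation
condition requires of its parameters. -/
theorem MapClosureCondition.of_tame [LinearOrder M] (hM : Tame L M)
    (h : ∀ B : L.ElementarySubstructure M,
      (∀ b ∈ B, PairNIP.theMap M b ∈ B) → ∀ (n : ℕ) (c : Fin n → M), ∃ d : Fin n → M,
        theMap M ''
            (Substructure.closure L ((B : Set M) ∪ Set.range c) : Set M) ⊆
          (Substructure.closure L (theMap M '' (B : Set M) ∪ Set.range d) : Set M)) :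
    MapClosureCondition L M := by
  classical
  intro B hB Y _ c
  obtain ⟨q, ⟨E⟩⟩ := Finite.exists_equiv_fin Y
  obtain ⟨d, hd⟩ := h ⟨B, hM.elementary B⟩ hB q (c ∘ E.symm)
  rw [E.symm.surjective.range_comp, show Set.range d = (Finset.univ.image d : Finset M) by simp] at hd
  obtain ⟨D, hD, hD'⟩ := hM.exists_finset_subset_closure (Finset.univ.image d) hd
  refine ⟨D.card, fun k => D.equivFin.symm k, fun k => ?_, ?_⟩
  · obtain ⟨x, -, hx⟩ := hD (D.equivFin.symm k).2
    exact ⟨x, hx⟩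
  · have : Set.range (fun k => (D.equivFin.symm k : M)) = D := by
      rw [← Function.comp_def, D.equivFin.symm.surjective.range_comp]
      exact Subtype.range_coe
    rw [this]
    exact hD'

theorem MapEquationCondition.of_fin
    (h : ∀ (m k n l : ℕ) (hnm : n ≤ m)
      (f : L.Term (Fin m ⊕ Fin k)) (g : L.Term (Fin n ⊕ Fin l))
      (a : ℕ → Fin m → M), Indiscernible (addUnary L) a →
      (∀ (i : ℕ) (j : Fin n), a i (Fin.castLE hnm j) ∈ Set.range (theMap M)) →
      ∀ (b₁ : Fin k → M) (b₂ : Fin l → M), (∀ j, b₂ j ∈ Set.range (theMap M)) →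
        let J : Set ℕ := {i | theMap M (f.realize (Sum.elim (a i) b₁)) =
          g.realize (Sum.elim (fun j : Fin n => a i (Fin.castLE hnm j)) b₂)}
        J.Finite ∨ Jᶜ.Finite) :
    MapEquationCondition L M := by
  intro X Y _ _ r n t g a ha har b e he
  obtain ⟨p, ⟨EX⟩⟩ := Finite.exists_equiv_fin X
  obtain ⟨q, ⟨EY⟩⟩ := Finite.exists_equiv_fin Y
  let σ : Fin (r + p) → Fin r ⊕ X := Sum.map id EX.symm ∘ finSumFinEquiv.symm
  have hσ : ∀ j : Fin r, σ (Fin.castLE (Nat.le_add_right r p) j) = Sum.inl j := fun j => by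
    have : Fin.castLE (Nat.le_add_right r p) j = Fin.castAdd p j := rfl
    simp [σ, this]
  have h1 := h (r + p) q r n (Nat.le_add_right r p)
    (t.relabel (Sum.map (fun x => Fin.natAdd r (EX x)) EY)) g (fun i => a i ∘ σ) (ha.reindex σ)
    (fun i j => by simpa only [Function.comp_apply, hσ] using har i j) (b ∘ EY.symm) e he
  have h2 : ∀ i, Sum.elim (a i ∘ σ) (b ∘ EY.symm) ∘ Sum.map (fun x => Fin.natAdd r (EX x)) EY =
      Sum.elim (a i ∘ Sum.inr) b := fun i => by
    funext y; rcases y with y | y <;> simp [σ]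
  simp only [Term.realize_relabel, h2, Function.comp_apply, hσ] at h1
  rcases h1 with h1 | h1
  · right
    have := h1.eventually_cofinite_notMem
    rw [Nat.cofinite_eq_atTop] at this
    exact this
  · left
    have := h1.eventually_cofinite_notMem
    rw [Nat.cofinite_eq_atTop] at this
    filter_upwards [this] with i hi
    exact not_not.1 hi

end QuantifierFree

/-- Dependence of a formula passes from a saturated structure to elementarily equivalent ones. -/
theorem DependentFormula.of_saturated {L : FirstOrder.Language.{u, v}} {M : Type w} [L.Structure M]
    [Nonempty M] {κ : Cardinal.{w}} (hsat : Saturated L M κ) (hκ : ℵ₀ ≤ κ) {N : Type*}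
    [L.Structure N] [Nonempty N] (hNM : ∀ φ : L.Sentence, N ⊨ φ → M ⊨ φ) {p q : ℕ}
    {φ : L.Formula (Fin p ⊕ Fin q)}
    (h : ∀ a : ℕ → Fin p → M, OrderIndiscernible L a → ∀ b : Fin q → M,
      EventuallyConstant fun i => φ.Realize (Sum.elim (a i) b)) : DependentFormula N φ := by
  intro a ha b
  obtain ⟨e, he⟩ := exists_realize_of_eventually hsat hNM (pure ()) (V := (ℕ × Fin p) ⊕ Fin q) (by
    refine le_trans ?_ (Cardinal.lift_le.2 hκ)
    rw [Cardinal.lift_aleph0, Cardinal.lift_le_aleph0]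
    exact Cardinal.mk_le_aleph0) (fun _ => Sum.elim (fun s => a s.1 s.2) b)
  simp only [eventually_pure] at he
  have he' : ∀ ψ : L.Formula ((ℕ × Fin p) ⊕ Fin q),
      ψ.Realize (Sum.elim (fun s => a s.1 s.2) b) ↔ ψ.Realize e := fun ψ =>
    ⟨he ψ, fun h1 => by
      by_contra h2
      exact (Formula.realize_not.1 (he ψ.not (Formula.realize_not.2 h2))) h1⟩
  have h1 := h (fun i x => e (Sum.inl (i, x))) (fun r ψ i j hi hj => by
    have key : ∀ i : Fin r → ℕ, (ψ.Realize (fun s => e (Sum.inl (i s.1, s.2))) ↔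
        ψ.Realize fun s => a (i s.1) s.2) := fun i => by
      have := he' (ψ.relabel fun s => Sum.inl (i s.1, s.2))
      rw [Formula.realize_relabel, Formula.realize_relabel] at this
      exact this.symm
    rw [key, key]
    exact ha r ψ i j hi hj) (fun k => e (Sum.inr k))
  have h2 : ∀ i, (φ.Realize (Sum.elim (fun x => e (Sum.inl (i, x))) fun k => e (Sum.inr k)) ↔
      φ.Realize (Sum.elim (a i) b)) := fun i => by
    have := he' (φ.relabel (Sum.map (fun x => (i, x)) id))
    rw [Formula.realize_relabel, Formula.realize_relabel] at this
    convert this.symm using 2 <;>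
    · funext k; rcases k with k | k <;> rfl
  simp only [h2] at h1
  rcases h1 with h1 | h1
  · obtain ⟨N, hN⟩ := eventually_atTop.1 h1
    exact ⟨N, .inl fun i hi => hN i hi.le⟩
  · obtain ⟨N, hN⟩ := eventually_atTop.1 h1
    exact ⟨N, .inr fun i hi => hN i hi.le⟩

theorem Extends.models {L : FirstOrder.Language.{u, v}} {Tf : (addUnary L).Theory} {T : L.Theory}
    (h : Extends Tf T) {M : Type w} [L.Structure M] [unaryLanguage.Structure M] [Nonempty M]
    (hM : M ⊨ Tf) : M ⊨ T :=
  T.model_iff.2 fun φ hφ => (LHom.realize_onSentence M (LHom.sumInl : L →ᴸ addUnary L) φ).1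
    ((h φ hφ).realize_sentence M)

end PairNIP

/-! ### Assembling the proof -/

theorem mainTheorem6
    (L : FirstOrder.Language.{u, v}) (S : PairNIP.OrderedGroupSymbols L)
    (T : L.Theory) (hTc : T.IsComplete)
    (hTo : PairNIP.OMinimalTheory.{u, v, w} S T)
    (hTg : PairNIP.ExtendsOrderedAbelianGroups.{u, v, w} S T)
    (hTqe : PairNIP.HasQE T) (hTu : PairNIP.HasUniversalAxiomatization T)
    (Tf : (PairNIP.addUnary L).Theory) (hTfc : Tf.IsComplete) (hTf : PairNIP.Extends Tf T)
    (M : Type w) [L.Structure M] [PairNIP.unaryLanguage.Structure M] [Nonempty M]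
    (κ : Cardinal.{w}) (hM : PairNIP.IsMonster M Tf κ)
    (h_i : PairNIP.HasQE Tf)
    (h_ii : ∀ (A : Type w) [L.Structure A] [PairNIP.unaryLanguage.Structure A] [Nonempty A],
      A ⊨ Tf → ∀ B : L.ElementarySubstructure A,
      (∀ b ∈ B, PairNIP.theMap A b ∈ B) → ∀ (n : ℕ) (c : Fin n → A), ∃ d : Fin n → A,
        PairNIP.theMap A ''
            (FirstOrder.Language.Substructure.closure L ((B : Set A) ∪ Set.range c) : Set A) ⊆
          (FirstOrder.Language.Substructure.closure L
            (PairNIP.theMap A '' (B : Set A) ∪ Set.range d) : Set A))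
    (h_iii : ∀ (m k n l : ℕ) (hnm : n ≤ m)
      (f : L.Term (Fin m ⊕ Fin k)) (g : L.Term (Fin n ⊕ Fin l))
      (a : ℕ → Fin m → M), PairNIP.Indiscernible (PairNIP.addUnary L) a →
      (∀ (i : ℕ) (j : Fin n), a i (Fin.castLE hnm j) ∈ Set.range (PairNIP.theMap M)) →
      ∀ (b₁ : Fin k → M) (b₂ : Fin l → M), (∀ j, b₂ j ∈ Set.range (PairNIP.theMap M)) →
        let J : Set ℕ := {i | PairNIP.theMap M (f.realize (Sum.elim (a i) b₁)) =
          g.realize (Sum.elim (fun j : Fin n => a i (Fin.castLE hnm j)) b₂)}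
        J.Finite ∨ Jᶜ.Finite) :
    PairNIP.DependentTheory.{max u 0, max v 0, w} Tf := by

  intro N _ _ κ' hN p q φ
  have hMT : M ⊨ T := hTf.models hM.model
  have hMTf : M ⊨ Tf := hM.model
  have hNTf : N ⊨ Tf := hN.model
  have hκ := hM.aleph0_lt
  obtain ⟨_, htame⟩ := PairNIP.tame_of_oMinimal hTqe hTu hMT (hTo M hMT)
  -- Condition 3 speaks only about `M`, while dependence is tested in an arbitrary monster model
  -- `N`. Completeness of `Tf` allows a failure in `N` to be copied into `M`.
  refine PairNIP.DependentFormula.of_saturated hM.saturated hκ.le (fun ψ hψ =>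
    (hTfc.realize_sentence_iff ψ M).2 ((hTfc.realize_sentence_iff ψ N).1 hψ)) ?_
  intro a ha b
  obtain ⟨ψ, hψ, hφψ⟩ := h_i (p + q) (φ.relabel finSumFinEquiv)
  have hψdep := PairNIP.DependentUnderTerms.of_isQF htame
    (hM.saturated.of_onLanguage (FirstOrder.Language.LHom.sumInl : L →ᴸ PairNIP.addUnary L)) hκ.le
    (fun hS w => hS.theMap hM.saturated hκ hM.card_lt (.of_tame htame (h_ii M hMTf))
      (PairNIP.MapEquationCondition.of_fin h_iii) w) hψ
  have h := hψdep.2 (fun k => FirstOrder.Language.Term.var (finSumFinEquiv.symm k)) a ha b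
  convert! h using 2 with i
  beta_reduce
  rw [← hφψ.realize_iff, FirstOrder.Language.Formula.realize_relabel]
  refine iff_of_eq (congrArg φ.Realize ?_)
  funext k
  simp
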